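/- Let $N\ge 1$, let $f:\mathbb R^N\to\mathbb R$ be $C^1$ with $L_f$-Lipschitz continuous gradient on $\operatorname{dom} g$ for some $L_f>0$, and let $g:\mathbb R^N\to\mathbb R\cup\{+\infty\}$ be proper, lower semi-continuous and prox-bounded, i.e. $\inf_y\big(g(y)+\frac1{2\lambda}\|y-x\|^2\big)>-\infty$ for some $\lambda>0$ and some $x$. Suppose that $h:=f+g$ is coercive ($h(x)\to+\infty$ as $\|x\|\to\infty$) and bounded from below. Notation. For a symmetric positive definite matrix $A$ write $\|x\|_A^2=\langle Ax,x\rangle$, and let $\varsigma(A)$ be the largest $c$ with $\|x\|_A^2\ge c\|x\|^2$ for all $x$. The function $g$ is semi-convex if for some (equivalently, every) symmetric positive definite $A$ there is $m\in\mathbb R$ such that $g-\frac m2\|\cdot\|_A^2$ is convex; the largest such $m$ is the semi-convexity modulus of $g$ with respect to $A$. Put $\sigma=1$ if $g$ is semi-convex and $\sigma=0$ otherwise. $\partial$ denotes the limiting subdifferential, and $\|\partial\varphi(z)\|_-:=\inf_{v\in\partial\varphi(z)}\|v\|$ (with $\inf\emptyset=+\infty$). Algorithm (variable metric iPiano). Let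 $\alpha_n>0$ with $\inf_n\alpha_n>0$, let $\beta_n\ge 0$, and let $A_n$ be symmetric positive definite matrices with $A_n\preceq\mathrm{id}$ and $\inf_n\varsigma(A_n)>0$. Start with $x^0\in\operatorname{dom}h$, $x^{-1}=x^0$, and for $n\ge0$ let $$y^n=x^n+\beta_n(x^n-x^{n-1}),\qquad x^{n+1}\in\arg\min_{x\in\mathbb R^N}\ g(x)+\langle\nabla f(x^n),x-x^n\rangle+\frac1{2\alpha_n}\|x-y^n\|_{A_n}^2 ,$$ where $L_n>\sigma m_n$ is such that $$f(x^{n+1})\le f(x^n)+\langle\nabla f(x^n),x^{n+1}-x^n\rangle+\frac{L_n}2\|x^{n+1}-x^n\|_{A_n}^2 ,$$ $m_n\in\mathbb R$ is, if $\sigma=1$, the semi-convexity modulus of $g$ with respect to $A_n$, and the quantities $$\delta_n^\sigma=\frac12\Big(\frac{1+\sigma-\beta_n}{\alpha_n}-(L_n-\sigma m_n)\Big),\qquad \gamma_n=\delta_n^\sigma-\frac{\beta_n}{2\alpha_n}$$ satisfy $\inf_n\gamma_n>0$ and $\delta_{n+1}^\sigma\|x^{n+1}-x^n\|_{A_{n+1}}^2\le\delta_n^\sigma\|x^{n+1}-x^n\|_{A_n}^2$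 for all $n\ge0$. A function $\varphi$ has the Kurdyka–Łojasiewicz property at $\bar z\in\operatorname{dom}\partial\varphi$ if there are $\eta\in(0,\infty]$, a neighbourhood $U$ of $\bar z$ and a continuous concave $\phi:[0,\eta)\to[0,\infty)$ with $\phi(0)=0$, $\phi\in C^1((0,\eta))$ and $\phi'>0$ on $(0,\eta)$ such that $\phi'(\varphi(z)-\varphi(\bar z))\,\|\partial\varphi(z)\|_-\ge1$ for all $z\in U$ with $\varphi(\bar z)<\varphi(z)<\varphi(\bar z)+\eta$. Theorem. Assume that $F(x,y,A,\delta)=h(x)+\delta\langle A(x-y),x-y\rangle$ on $\mathbb R^N\times\mathbb R^N\times\mathbb R^{N\times N}\times\mathbb R$ is a Kurdyka–Łojasiewicz function; it suffices that it has the Kurdyka–Łojasiewicz property at all $(x,y,A,\delta)\in\operatorname{dom}\partial F$ with $A$ symmetric positive definite and $\delta>0$. Let $(x^n)$ be generated by the algorithm. Then $$\sum_{k=0}^\infty\|x^{k+1}-x^k\|<\infty ,$$ and $(x^n)$ converges to a critical point $x^*\in\operatorname{dom}h$ of $h$, i.e. $0\in\partial h(x^*)$, equivalently $-\nabla f(x^*)\in\partial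 g(x^*)$. -/

import Mathlib

open Filter Topology

namespace VMiPiano

/-- The space `ℝ^N` with its standard Euclidean structure. -/
abbrev Vec (N : ℕ) := EuclideanSpace ℝ (Fin N)

/-! ### Extended-real-valued functions and subdifferentials -/

section Subdifferential

variable {E : Type*} [NormedAddCommGroup E] [InnerProductSpace ℝ E]

/-- The domain `{x | φ x < +∞}`. -/
def effDom (φ : E → EReal) : Set E := {x | φ x < ⊤}

/-- Proper: nowhere `-∞` and not everywhere `+∞`. -/
def IsProper (φ : E → EReal) : Prop := (∀ x, φ x ≠ ⊥) ∧ (effDom φ).Nonempty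

/-- Convexity of an extended-real-valued function: its epigraph is a convex set. -/
def IsConvexFun (φ : E → EReal) : Prop := Convex ℝ {p : E × ℝ | φ p.1 ≤ (p.2 : EReal)}

/-- The Fréchet subdifferential: `v` belongs to it at `z ∈ dom φ` iff
`liminf_{x → z, x ≠ z} (φ x - φ z - ⟪v, x - z⟫) / ‖x - z‖ ≥ 0`, written with `ε`. -/
def frechetSubdiff (φ : E → EReal) (z : E) : Set E :=
  {v | z ∈ effDom φ ∧ ∀ ε : ℝ, 0 < ε → ∀ᶠ x in 𝓝 z,
    φ z + ((inner ℝ v (x - z) - ε * ‖x - z‖ : ℝ) : EReal) ≤ φ x}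

/-- The limiting subdifferential (through `φ`-attentive convergence). -/
def limSubdiff (φ : E → EReal) (z : E) : Set E :=
  {v | z ∈ effDom φ ∧ ∃ (x : ℕ → E) (w : ℕ → E),
    Tendsto x atTop (𝓝 z) ∧ Tendsto (fun n => φ (x n)) atTop (𝓝 (φ z)) ∧
    (∀ n, w n ∈ frechetSubdiff φ (x n)) ∧ Tendsto w atTop (𝓝 v)}

/-- A critical point: a point of the domain with `0 ∈ ∂φ`. -/
def IsCriticalPoint (φ : E → EReal) (z : E) : Prop :=
  z ∈ effDom φ ∧ (0 : E) ∈ limSubdiff φ z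

/-- The lazy slope `inf {‖v‖ | v ∈ ∂φ(z)} ∈ [0, ∞]`, with `inf ∅ = ∞`. -/
noncomputable def lazySlope (φ : E → EReal) (z : E) : ENNReal :=
  ⨅ v ∈ limSubdiff φ z, ENNReal.ofReal ‖v‖

/-- `ψ` is a desingularization function on `[0, η)`, where `η ∈ (0, ∞]`: it is continuous, concave
and non-negative on `[0, η)`, vanishes at `0`, and on `(0, η)` it is `C¹` with positive
derivative. -/
structure IsDesingularizer (η : EReal) (ψ : ℝ → ℝ) : Prop where
  continuousOn : ContinuousOn ψ {s : ℝ | 0 ≤ s ∧ (s : EReal) < η}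
  concaveOn : ConcaveOn ℝ {s : ℝ | 0 ≤ s ∧ (s : EReal) < η} ψ
  nonneg : ∀ s : ℝ, 0 ≤ s → (s : EReal) < η → 0 ≤ ψ s
  zero : ψ 0 = 0
  contDiffOn : ContDiffOn ℝ 1 ψ {s : ℝ | 0 < s ∧ (s : EReal) < η}
  deriv_pos : ∀ s : ℝ, 0 < s → (s : EReal) < η → 0 < deriv ψ s

/-- The Kurdyka–Łojasiewicz property of `φ` at `z`, a point of `dom ∂φ`.  (In the inequality
both values are finite as soon as `φ` is nowhere `-∞`, so that `toReal` is harmless.) -/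
def HasKLProperty (φ : E → EReal) (z : E) : Prop :=
  (limSubdiff φ z).Nonempty ∧
  ∃ (η : EReal) (U : Set E) (ψ : ℝ → ℝ), 0 < η ∧ U ∈ 𝓝 z ∧ IsDesingularizer η ψ ∧
    ∀ x ∈ U, φ z < φ x → φ x < φ z + η →
      1 ≤ ENNReal.ofReal (deriv ψ ((φ x).toReal - (φ z).toReal)) * lazySlope φ x

/-- `φ` is a Kurdyka–Łojasiewicz function on `D`: it is lower semicontinuous on `D` and has the
Kurdyka–Łojasiewicz property at each point of `D ∩ dom ∂φ`.  For `D = univ` this is the notion of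
a Kurdyka–Łojasiewicz function. -/
def IsKLFunctionOn (φ : E → EReal) (D : Set E) : Prop :=
  LowerSemicontinuousOn φ D ∧ ∀ z ∈ D, (limSubdiff φ z).Nonempty → HasKLProperty φ z

/-- Prox-boundedness: some Moreau envelope of `φ` is `> -∞` at some point. -/
def IsProxBounded (φ : E → EReal) : Prop :=
  ∃ r : ℝ, 0 < r ∧ ∃ x : E, ⊥ < ⨅ y : E, φ y + ((1 / (2 * r) * ‖y - x‖ ^ 2 : ℝ) : EReal)

end Subdifferential

/-! ### The metric induced by a matrix -/

/-- `⟨A x, x⟩`, which is `‖x‖_A²` for a symmetric positive definite `A`. -/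
noncomputable def sqNorm {N : ℕ} (A : Matrix (Fin N) (Fin N) ℝ) (x : Vec N) : ℝ :=
  inner ℝ (Matrix.toEuclideanLin A x) x

/-- `ς(A)`: the largest `c` with `‖x‖_A² ≥ c ‖x‖²` for all `x`. -/
noncomputable def varsigma {N : ℕ} (A : Matrix (Fin N) (Fin N) ℝ) : ℝ :=
  sSup {c : ℝ | ∀ x : Vec N, c * ‖x‖ ^ 2 ≤ sqNorm A x}

/-- The `m ∈ ℝ` for which `g - (m/2) ‖·‖_A²` is convex. -/
def semiConvexModuli {N : ℕ} (g : Vec N → EReal) (A : Matrix (Fin N) (Fin N) ℝ) : Set ℝ :=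
  {m : ℝ | IsConvexFun fun x => g x - ((m / 2 * sqNorm A x : ℝ) : EReal)}

/-- `g` is semi-convex with respect to the metric induced by some symmetric positive definite
matrix (equivalently, by any of them). -/
def IsSemiConvex {N : ℕ} (g : Vec N → EReal) : Prop :=
  ∃ A : Matrix (Fin N) (Fin N) ℝ, A.PosDef ∧ (semiConvexModuli g A).Nonempty

/-! ### The algorithm -/

/-- The objective `h = f + g`. -/
noncomputable def objective {N : ℕ} (f : Vec N → ℝ) (g : Vec N → EReal) (x : Vec N) : EReal :=
  (f x : EReal) + g x

/-- The extrapolated point `y^n = x^n + β_n (x^n - x^{n-1})`, where `x^{-1} = x^0` (this is what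
the truncated subtraction `0 - 1 = 0` gives). -/
noncomputable def extrapolate {N : ℕ} (β : ℕ → ℝ) (x : ℕ → Vec N) (n : ℕ) : Vec N :=
  x n + β n • (x n - x (n - 1))

/-- The model `g(z) + ⟨∇f(u), z - u⟩ + 1/(2a) ‖z - y‖_A²`, as a function of `z`. -/
noncomputable def model {N : ℕ} (f : Vec N → ℝ) (g : Vec N → EReal) (u y : Vec N) (a : ℝ)
    (A : Matrix (Fin N) (Fin N) ℝ) (z : Vec N) : EReal :=
  g z + ((inner ℝ (gradient f u) (z - u) + 1 / (2 * a) * sqNorm A (z - y) : ℝ) : EReal)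

/-- `δ_n^σ = ½ ((1 + σ - β_n) / α_n - (L_n - σ m_n))`. -/
noncomputable def deltaPar (σ : ℝ) (α β L m : ℕ → ℝ) (n : ℕ) : ℝ :=
  1 / 2 * ((1 + σ - β n) / α n - (L n - σ * m n))

/-- `γ_n = δ_n^σ - β_n / (2 α_n)`. -/
noncomputable def gammaPar (σ : ℝ) (α β L m : ℕ → ℝ) (n : ℕ) : ℝ :=
  deltaPar σ α β L m n - β n / (2 * α n)

/-- `x` is generated by the variable metric iPiano algorithm for `f + g`, with flag `σ`, step
sizes `α`, inertial parameters `β`, metrics `A`, majorization constants `L` and semi-convexity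
moduli `m` (which matter only when `σ = 1`). -/
structure IsVMiPiano {N : ℕ} (f : Vec N → ℝ) (g : Vec N → EReal) (σ : ℝ) (α β : ℕ → ℝ)
    (A : ℕ → Matrix (Fin N) (Fin N) ℝ) (L m : ℕ → ℝ) (x : ℕ → Vec N) : Prop where
  /-- `σ = 1` if `g` is semi-convex and `σ = 0` otherwise. -/
  flag : (IsSemiConvex g ∧ σ = 1) ∨ (¬ IsSemiConvex g ∧ σ = 0)
  /-- If `σ = 1`, then `m_n` is the semi-convexity modulus of `g` with respect to `A_n`. -/
  modulus : σ = 1 → ∀ n, IsGreatest (semiConvexModuli g (A n)) (m n)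
  alpha_pos : ∀ n, 0 < α n
  /-- `inf_n α_n > 0` -/
  alpha_inf : ∃ c : ℝ, 0 < c ∧ ∀ n, c ≤ α n
  beta_nonneg : ∀ n, 0 ≤ β n
  metric_posDef : ∀ n, (A n).PosDef
  /-- `A_n ⪯ id` -/
  metric_le_one : ∀ n, (1 - A n).PosSemidef
  /-- `inf_n ς(A_n) > 0` -/
  metric_inf : ∃ c : ℝ, 0 < c ∧ ∀ n, c ≤ varsigma (A n)
  start : x 0 ∈ effDom (objective f g)
  /-- `x^{n+1}` is a global minimizer of the model. -/
  update : ∀ n, ∀ z : Vec N,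
    model f g (x n) (extrapolate β x n) (α n) (A n) (x (n + 1)) ≤
      model f g (x n) (extrapolate β x n) (α n) (A n) z
  L_gt : ∀ n, σ * m n < L n
  majorize : ∀ n, f (x (n + 1)) ≤ f (x n) + inner ℝ (gradient f (x n)) (x (n + 1) - x n)
    + L n / 2 * sqNorm (A n) (x (n + 1) - x n)
  /-- `inf_n γ_n > 0` -/
  gamma_inf : ∃ c : ℝ, 0 < c ∧ ∀ n, c ≤ gammaPar σ α β L m n
  delta_step : ∀ n,
    deltaPar σ α β L m (n + 1) * sqNorm (A (n + 1)) (x (n + 1) - x n) ≤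
      deltaPar σ α β L m n * sqNorm (A n) (x (n + 1) - x n)

/-! ### The Lyapunov function -/

/-- The Euclidean space `ℝ^N × ℝ^N × ℝ^{N×N} × ℝ` of the variables `(x, y, A, δ)`. -/
abbrev LyapSpace (N : ℕ) :=
  WithLp 2 (Vec N × WithLp 2 (Vec N × WithLp 2 (EuclideanSpace ℝ (Fin N × Fin N) × ℝ)))

/-- The `x`-component. -/
def LyapSpace.xPart {N : ℕ} (p : LyapSpace N) : Vec N := p.fst

/-- The `y`-component. -/
def LyapSpace.yPart {N : ℕ} (p : LyapSpace N) : Vec N := p.snd.fst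

/-- The `A`-component, as a matrix. -/
def LyapSpace.matPart {N : ℕ} (p : LyapSpace N) : Matrix (Fin N) (Fin N) ℝ :=
  Matrix.of fun i j => p.snd.snd.fst (i, j)

/-- The `δ`-component. -/
def LyapSpace.deltaPart {N : ℕ} (p : LyapSpace N) : ℝ := p.snd.snd.snd

/-- `F(x, y, A, δ) = h(x) + δ ‖x - y‖_A²`, with `‖x - y‖_A² = ⟨A (x - y), x - y⟩`. -/
noncomputable def lyapunov {N : ℕ} (f : Vec N → ℝ) (g : Vec N → EReal) (p : LyapSpace N) : EReal :=
  objective f g p.xPart + ((p.deltaPart * sqNorm p.matPart (p.xPart - p.yPart) : ℝ) : EReal)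

/-- The region of the `(x, y, A, δ)` with `A` symmetric positive definite and `δ > 0`. -/
def LyapRegion (N : ℕ) : Set (LyapSpace N) :=
  {p | p.matPart.PosDef ∧ 0 < p.deltaPart}

end VMiPiano

/-!
The Lyapunov values `Φ n = h (x (n+1)) + δ (n+1) ‖x (n+1) - x n‖²_{A (n+1)}` decrease by at least
`c ‖x (n+1) - x n‖²`: compare the minimized model at `x (n+1)` and at `x n`, and use the descent
inequality for `f` and, when `g` is semi-convex, the quadratic growth of the model at its minimizer.
The optimality condition of the model gives a subgradient of `F` at
`(x (n+1), x n, A (n+1), δ (n+1))` whose norm is bounded by a multiple of the sum of the last two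
step lengths.

The sequence of these points is bounded.  Its limit points lie in the region where `A` is positive
definite and `δ > 0`, on a single level set of `F`, and are critical points of `F`, so each of them
has the Kurdyka–Łojasiewicz property.  Since they form a compact set, the sum of finitely many
desingularizing functions serves a whole neighbourhood of it, which the sequence eventually enters.
Concavity of that function turns the decrease of `Φ` and the subgradient bound into finite length.
-/

namespace VMiPiano

theorem summable_of_le_mul_add_sub {d b : ℕ → ℝ} {θ : ℝ} (hθ₀ : 0 ≤ θ) (hθ : θ < 1 / 2)
    (hd : ∀ n, 0 ≤ d n) (hb : ∀ n, 0 ≤ b n)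
    (h : ∀ n, d (n + 1) ≤ θ * (d (n + 1) + d n) + (b n - b (n + 1))) : Summable d := by
  have hsum (n : ℕ) :
      (1 - 2 * θ) * ∑ k ∈ Finset.range n, d (k + 1) + θ * d n + b n ≤ θ * d 0 + b 0 := by
    induction n with
    | zero => simp
    | succ n ih =>
      rw [Finset.sum_range_succ]
      linarith [h n]
  rw [← summable_nat_add_iff 1]
  refine summable_of_sum_range_le (c := (θ * d 0 + b 0) / (1 - 2 * θ)) (fun n => hd _) fun n => ?_
  rw [le_div_iff₀' (by linarith)]
  linarith [hsum n, mul_nonneg hθ₀ (hd n), hb n]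

theorem le_quarter_add_of_sq_le_mul {r s t : ℝ} (hs : 0 ≤ s) (ht : 0 ≤ t)
    (h : r ^ 2 ≤ s * t) : r ≤ s / 4 + t :=
  (abs_le_of_sq_le_sq' (by nlinarith [sq_nonneg (s / 4 - t)]) (by positivity)).2

namespace IsDesingularizer

variable {η η' : EReal} {ψ ψ' : ℝ → ℝ}

theorem mono (h : IsDesingularizer η ψ) (hη : η' ≤ η) : IsDesingularizer η' ψ := by
  have hsub : {s : ℝ | 0 ≤ s ∧ (s : EReal) < η'} ⊆ {s : ℝ | 0 ≤ s ∧ (s : EReal) < η} :=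
    fun s hs => ⟨hs.1, hs.2.trans_le hη⟩
  have hord : Set.OrdConnected {s : ℝ | 0 ≤ s ∧ (s : EReal) < η'} :=
    ⟨fun _ ha _ hb _ hc =>
      ⟨ha.1.trans hc.1, (EReal.coe_le_coe_iff.2 hc.2).trans_lt hb.2⟩⟩
  exact
    { continuousOn := h.continuousOn.mono hsub
      concaveOn := h.concaveOn.subset hsub hord.convex
      nonneg := fun s hs hsη => h.nonneg s hs (hsη.trans_le hη)
      zero := h.zero
      contDiffOn := h.contDiffOn.mono fun s hs => ⟨hs.1, hs.2.trans_le hη⟩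
      deriv_pos := fun s hs hsη => h.deriv_pos s hs (hsη.trans_le hη) }

protected theorem id : IsDesingularizer ⊤ id where
  continuousOn := continuousOn_id
  concaveOn := by
    have : {s : ℝ | 0 ≤ s ∧ (s : EReal) < ⊤} = Set.Ici 0 := by ext s; simp
    rw [this]
    exact concaveOn_id (convex_Ici 0)
  nonneg s hs _ := hs
  zero := rfl
  contDiffOn := contDiffOn_id
  deriv_pos s _ _ := by simp

theorem differentiableAt (h : IsDesingularizer η ψ) {s : ℝ} (hs : 0 < s) (hsη : (s : EReal) < η) :
    DifferentiableAt ℝ ψ s :=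
  differentiableAt_of_deriv_ne_zero (h.deriv_pos s hs hsη).ne'

theorem deriv_add (h : IsDesingularizer η ψ) (h' : IsDesingularizer η ψ') {s : ℝ} (hs : 0 < s)
    (hsη : (s : EReal) < η) : deriv (ψ + ψ') s = deriv ψ s + deriv ψ' s :=
  _root_.deriv_add (h.differentiableAt hs hsη) (h'.differentiableAt hs hsη)

theorem add (h : IsDesingularizer η ψ) (h' : IsDesingularizer η ψ') :
    IsDesingularizer η (ψ + ψ') where
  continuousOn := h.continuousOn.add h'.continuousOn
  concaveOn := h.concaveOn.add h'.concaveOn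
  nonneg s hs hsη := add_nonneg (h.nonneg s hs hsη) (h'.nonneg s hs hsη)
  zero := by simp [h.zero, h'.zero]
  contDiffOn := h.contDiffOn.add h'.contDiffOn
  deriv_pos s hs hsη := by
    rw [h.deriv_add h' hs hsη]
    exact add_pos (h.deriv_pos s hs hsη) (h'.deriv_pos s hs hsη)

theorem deriv_mul_sub_le (h : IsDesingularizer η ψ) {s t : ℝ} (ht : 0 ≤ t) (hts : t ≤ s)
    (hs : 0 < s) (hsη : (s : EReal) < η) : deriv ψ s * (s - t) ≤ ψ s - ψ t := by
  rcases hts.eq_or_lt with rfl | hlt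
  · simp
  have htη : (t : EReal) < η := (EReal.coe_lt_coe_iff.2 hlt).trans hsη
  have hslope := h.concaveOn.deriv_le_slope ⟨ht, htη⟩ ⟨hs.le, hsη⟩ hlt
    (h.differentiableAt hs hsη)
  rwa [slope_def_field, le_div_iff₀ (sub_pos.2 hlt)] at hslope

/-- The decrease `c d² ≤ a - a⁺` and the Kurdyka–Łojasiewicz inequality bound `d²` by the product
of the last two steps with the decrease of `ψ (a n)`; taking a mean turns this into a recursion
for `d` alone, up to a telescoping term. -/
theorem summable_of_descent (h : IsDesingularizer η ψ) {a d : ℕ → ℝ} {B c : ℝ} (hc : 0 < c)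
    (hd : ∀ n, 0 ≤ d n) (ha : ∀ n, 0 < a n) (haη : ∀ n, (a n : EReal) < η)
    (hdesc : ∀ n, c * d n ^ 2 ≤ a n - a (n + 1))
    (hKL : ∀ n, 1 ≤ deriv ψ (a (n + 1)) * (B * (d (n + 1) + d n))) : Summable d := by
  have hB : 0 ≤ B := by
    by_contra! hB
    have := mul_nonneg (h.deriv_pos _ (ha 1) (haη 1)).le (add_nonneg (hd 1) (hd 0))
    nlinarith [hKL 0]
  refine summable_of_le_mul_add_sub (θ := 1 / 4) (b := fun n => B / c * ψ (a (n + 1)))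
    (by norm_num) (by norm_num) hd
    (fun n => mul_nonneg (by positivity) (h.nonneg _ (ha _).le (haη _))) fun n => ?_
  have hsteps : 0 ≤ d (n + 1) + d n := add_nonneg (hd _) (hd _)
  have hψ' := h.deriv_pos _ (ha (n + 1)) (haη (n + 1))
  have hle : a (n + 2) ≤ a (n + 1) := by nlinarith [hdesc (n + 1), sq_nonneg (d (n + 1))]
  have hconc := h.deriv_mul_sub_le (ha (n + 2)).le hle (ha (n + 1)) (haη (n + 1))
  have hmul : c * d (n + 1) ^ 2 ≤
      B * (d (n + 1) + d n) * (ψ (a (n + 1)) - ψ (a (n + 2))) := calc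
    c * d (n + 1) ^ 2 ≤ a (n + 1) - a (n + 2) := hdesc (n + 1)
    _ ≤ deriv ψ (a (n + 1)) * (B * (d (n + 1) + d n)) * (a (n + 1) - a (n + 2)) :=
      le_mul_of_one_le_left (sub_nonneg.2 hle) (hKL n)
    _ = B * (d (n + 1) + d n) * (deriv ψ (a (n + 1)) * (a (n + 1) - a (n + 2))) := by ring
    _ ≤ B * (d (n + 1) + d n) * (ψ (a (n + 1)) - ψ (a (n + 2))) := by gcongr
  have hmean := le_quarter_add_of_sq_le_mul (r := d (n + 1))
    (t := B / c * (ψ (a (n + 1)) - ψ (a (n + 2)))) hsteps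
    (mul_nonneg (by positivity) ((mul_nonneg hψ'.le (sub_nonneg.2 hle)).trans hconc)) (by
      rw [← mul_le_mul_iff_right₀ hc]
      refine hmul.trans_eq ?_
      field_simp)
  linarith [hmean]

end IsDesingularizer

/-! ### The Kurdyka–Łojasiewicz inequality -/

section KurdykaLojasiewicz

variable {E : Type*} [NormedAddCommGroup E] [InnerProductSpace ℝ E] {φ : E → EReal} {ζ : ℝ}

theorem lazySlope_le {z v : E} (hv : v ∈ limSubdiff φ z) :
    lazySlope φ z ≤ ENNReal.ofReal ‖v‖ :=
  iInf₂_le v hv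

/-- The Kurdyka–Łojasiewicz inequality `ψ'(φ x - ζ) ‖∂φ(x)‖₋ ≥ 1` at a point `x` with
`ζ < φ x < ζ + η`.  It is written with the excess `s = φ x - ζ`, so as to be meaningful for a
fixed level `ζ` instead of a fixed base point. -/
def KLInequality (φ : E → EReal) (ζ : ℝ) (η : EReal) (ψ : ℝ → ℝ) (x : E) : Prop :=
  ∀ s : ℝ, 0 < s → (s : EReal) < η → φ x = ((ζ + s : ℝ) : EReal) →
    1 ≤ ENNReal.ofReal (deriv ψ s) * lazySlope φ x

theorem KLInequality.mono {η η' : EReal} {ψ ψ' : ℝ → ℝ} {x : E} (h : KLInequality φ ζ η ψ x)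
    (hη : η' ≤ η) (hψ : ∀ s : ℝ, 0 < s → (s : EReal) < η' → deriv ψ s ≤ deriv ψ' s) :
    KLInequality φ ζ η' ψ' x := fun s hs hsη hφ =>
  (h s hs (hsη.trans_le hη) hφ).trans (by gcongr; exact hψ s hs hsη)

theorem HasKLProperty.exists_eventually_klInequality {p : E} (h : HasKLProperty φ p)
    (hp : φ p = ζ) : ∃ (η : EReal) (ψ : ℝ → ℝ), 0 < η ∧ IsDesingularizer η ψ ∧
      ∀ᶠ x in 𝓝 p, KLInequality φ ζ η ψ x := by
  obtain ⟨-, η, U, ψ, hη, hU, hψ, hKL⟩ := h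
  refine ⟨η, ψ, hη, hψ, ?_⟩
  filter_upwards [hU] with x hx s hs hsη hφ
  have hlt : φ p < φ x := by
    rw [hp, hφ, EReal.coe_lt_coe_iff]
    linarith
  have hlt' : φ x < φ p + η := by
    rw [hp, hφ, EReal.coe_add]
    exact EReal.add_lt_add_left_coe hsη ζ
  have hexcess : (φ x).toReal - (φ p).toReal = s := by
    rw [hp, hφ, EReal.toReal_coe, EReal.toReal_coe, add_sub_cancel_left]
  exact hexcess ▸ hKL x hx hlt hlt'

theorem exists_eventually_nhdsSet_klInequality {K : Set E} (hK : IsCompact K)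
    (hφ : ∀ p ∈ K, φ p = ζ) (hKL : ∀ p ∈ K, HasKLProperty φ p) :
    ∃ (η : EReal) (ψ : ℝ → ℝ), 0 < η ∧ IsDesingularizer η ψ ∧
      ∀ᶠ x in 𝓝ˢ K, KLInequality φ ζ η ψ x := by
  refine hK.induction_on (p := fun S => ∃ (η : EReal) (ψ : ℝ → ℝ), 0 < η ∧
    IsDesingularizer η ψ ∧ ∀ᶠ x in 𝓝ˢ S, KLInequality φ ζ η ψ x) ?_ ?_ ?_ ?_
  · exact ⟨⊤, id, EReal.zero_lt_top, .id, by simp⟩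
  · rintro S T hST ⟨η, ψ, hη, hψ, hT⟩
    exact ⟨η, ψ, hη, hψ, hT.filter_mono (nhdsSet_mono hST)⟩
  · rintro S T ⟨η₁, ψ₁, hη₁, hψ₁, hS⟩ ⟨η₂, ψ₂, hη₂, hψ₂, hT⟩
    have hψ₁' := hψ₁.mono (min_le_left η₁ η₂)
    have hψ₂' := hψ₂.mono (min_le_right η₁ η₂)
    refine ⟨min η₁ η₂, ψ₁ + ψ₂, lt_min hη₁ hη₂, hψ₁'.add hψ₂', ?_⟩
    rw [nhdsSet_union, eventually_sup]
    constructor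
    · filter_upwards [hS] with x hx
      refine hx.mono (min_le_left _ _) fun s hs hsη => ?_
      rw [hψ₁'.deriv_add hψ₂' hs hsη]
      exact le_add_of_nonneg_right (hψ₂'.deriv_pos s hs hsη).le
    · filter_upwards [hT] with x hx
      refine hx.mono (min_le_right _ _) fun s hs hsη => ?_
      rw [hψ₁'.deriv_add hψ₂' hs hsη]
      exact le_add_of_nonneg_left (hψ₁'.deriv_pos s hs hsη).le
  · intro p hp
    obtain ⟨η, ψ, hη, hψ, hev⟩ := (hKL p hp).exists_eventually_klInequality (hφ p hp)
    obtain ⟨V, hVsub, hVopen, hpV⟩ := eventually_nhds_iff.1 hev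
    refine ⟨V, mem_nhdsWithin_of_mem_nhds (hVopen.mem_nhds hpV), η, ψ, hη, hψ, ?_⟩
    rw [hVopen.nhdsSet_eq]
    exact hVsub

theorem summable_of_descent_of_le_limit {Φ d : ℕ → ℝ} {c : ℝ} (hc : 0 < c)
    (hdesc : ∀ n, c * d n ^ 2 ≤ Φ n - Φ (n + 1)) (hΦ : Tendsto Φ atTop (𝓝 ζ)) {n₀ : ℕ}
    (hn₀ : Φ n₀ ≤ ζ) : Summable d := by
  have hanti : Antitone Φ := antitone_nat_of_succ_le fun n => by
    nlinarith [hdesc n, sq_nonneg (d n)]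
  rw [← summable_nat_add_iff n₀]
  refine summable_zero.congr fun n => ?_
  have hle : c * d (n + n₀) ^ 2 ≤ 0 := by
    linarith [hdesc (n + n₀), hanti.le_of_tendsto hΦ (n + n₀ + 1), hanti (Nat.le_add_left n₀ n)]
  exact ((pow_eq_zero_iff two_ne_zero).1 (le_antisymm (nonpos_of_mul_nonpos_right hle hc)
    (sq_nonneg _))).symm

theorem isCompact_setOf_mapClusterPt {X : Type*} [PseudoMetricSpace X] [ProperSpace X] {z : ℕ → X}
    (hz : Bornology.IsBounded (Set.range z)) : IsCompact {p | MapClusterPt p atTop z} :=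
  hz.isCompact_closure.of_isClosed_subset isClosed_setOfPred_clusterPt fun _ hp =>
    closure_mono (Set.image_subset_range _ _)
      (mapClusterPt_atTop_iff_forall_mem_closure.1 hp 0)

theorem summable_of_descent_of_hasKLProperty [ProperSpace E] {z : ℕ → E} {Φ d : ℕ → ℝ}
    {B c : ℝ} (hc : 0 < c) (hd : ∀ n, 0 ≤ d n) (hz : Bornology.IsBounded (Set.range z))
    (hφ : ∀ n, φ (z n) = Φ n) (hΦ : Tendsto Φ atTop (𝓝 ζ))
    (hdesc : ∀ n, c * d n ^ 2 ≤ Φ n - Φ (n + 1))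
    (hslope : ∀ n, lazySlope φ (z (n + 1)) ≤ ENNReal.ofReal (B * (d (n + 1) + d n)))
    (hlim : ∀ p, MapClusterPt p atTop z → φ p = ζ ∧ HasKLProperty φ p) : Summable d := by
  by_cases hpos : ∀ n, ζ < Φ n
  swap
  · push Not at hpos
    exact summable_of_descent_of_le_limit hc hdesc hΦ hpos.choose_spec
  have hzK : Tendsto z atTop (𝓝ˢ {p | MapClusterPt p atTop z}) :=
    hz.isCompact_closure.tendsto_nhdsSet_of_mapClusterPt
      (Eventually.of_forall fun n => subset_closure (Set.mem_range_self n)) fun _ _ hp => hp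
  obtain ⟨η, ψ, hη, hψ, hKL⟩ := exists_eventually_nhdsSet_klInequality
    (isCompact_setOf_mapClusterPt hz)
    (fun p hp => (hlim p hp).1) (fun p hp => (hlim p hp).2)
  have hgap : Tendsto (fun n => ((Φ n - ζ : ℝ) : EReal)) atTop (𝓝 0) :=
    EReal.tendsto_coe.2 (by simpa using hΦ.sub_const ζ)
  obtain ⟨n₀, hn₀⟩ := eventually_atTop.1
    ((hzK.eventually hKL).and (hgap.eventually (gt_mem_nhds hη)))
  rw [← summable_nat_add_iff n₀]
  refine hψ.summable_of_descent (a := fun n => Φ (n + n₀) - ζ) (B := B) hc (fun n => hd _)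
    (fun n => sub_pos.2 (hpos _)) (fun n => (hn₀ _ (Nat.le_add_left _ _)).2)
    (fun n => ?_) fun n => ?_
  · rw [sub_sub_sub_cancel_right, Nat.add_right_comm]
    exact hdesc _
  · have hmem : n₀ ≤ n + 1 + n₀ := Nat.le_add_left _ _
    have hs : 0 < Φ (n + 1 + n₀) - ζ := sub_pos.2 (hpos _)
    have hsη := (hn₀ _ hmem).2
    have hKLn := (hn₀ _ hmem).1 _ hs hsη (by rw [hφ, add_sub_cancel])
    rw [← ENNReal.one_le_ofReal, ENNReal.ofReal_mul (hψ.deriv_pos _ hs hsη).le]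
    refine hKLn.trans ?_
    gcongr
    rw [Nat.add_right_comm]
    exact hslope _

end KurdykaLojasiewicz

/-! ### Subdifferential calculus -/

section SubdifferentialCalculus

variable {E : Type*} [NormedAddCommGroup E] [InnerProductSpace ℝ E] {φ : E → EReal} {z v : E}

theorem frechetSubdiff_subset_limSubdiff (φ : E → EReal) (z : E) :
    frechetSubdiff φ z ⊆ limSubdiff φ z := fun v hv =>
  ⟨hv.1, fun _ => z, fun _ => v, tendsto_const_nhds, tendsto_const_nhds, fun _ => hv,
    tendsto_const_nhds⟩

theorem zero_mem_frechetSubdiff_of_forall_le (hz : z ∈ effDom φ) (hmin : ∀ x, φ z ≤ φ x) :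
    (0 : E) ∈ frechetSubdiff φ z := by
  refine ⟨hz, fun ε hε => Eventually.of_forall fun x => le_trans ?_ (hmin x)⟩
  have hneg : ((inner ℝ (0 : E) (x - z) - ε * ‖x - z‖ : ℝ) : EReal) ≤ (0 : ℝ) := by
    rw [EReal.coe_le_coe_iff, inner_zero_left, zero_sub, neg_nonpos]
    positivity
  simpa using add_le_add_right hneg (φ z)

theorem continuous_gradient [CompleteSpace E] {q : E → ℝ} (hq : ContDiff ℝ 1 q) :
    Continuous (gradient q) :=
  (InnerProductSpace.toDual ℝ E).symm.continuous.comp (hq.continuous_fderiv one_ne_zero)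

theorem add_mem_frechetSubdiff [CompleteSpace E] {q : E → ℝ} {w : E}
    (hv : v ∈ frechetSubdiff φ z) (hq : HasGradientAt q w z) :
    v + w ∈ frechetSubdiff (fun x => φ x + (q x : EReal)) z := by
  refine ⟨EReal.add_lt_top hv.1.ne (EReal.coe_ne_top _), fun ε hε => ?_⟩
  filter_upwards [hv.2 (ε / 2) (half_pos hε),
    (hasGradientAt_iff_isLittleO.1 hq).def (half_pos hε)] with x hφx hqx
  have hqx' : q z + (inner ℝ w (x - z) - ε / 2 * ‖x - z‖) ≤ q x := by
    linarith [neg_le_of_abs_le hqx]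
  calc φ z + (q z : EReal) + ((inner ℝ (v + w) (x - z) - ε * ‖x - z‖ : ℝ) : EReal)
      = φ z + ((inner ℝ v (x - z) - ε / 2 * ‖x - z‖ : ℝ) : EReal) +
        ((q z + (inner ℝ w (x - z) - ε / 2 * ‖x - z‖) : ℝ) : EReal) := by
        rw [add_assoc, add_assoc, ← EReal.coe_add, ← EReal.coe_add, inner_add_left]
        congr 2
        ring
    _ ≤ φ x + (q x : EReal) := add_le_add hφx (EReal.coe_le_coe_iff.2 hqx')

theorem add_gradient_mem_limSubdiff [CompleteSpace E] {q : E → ℝ} (hv : v ∈ limSubdiff φ z)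
    (hq : ContDiff ℝ 1 q) : v + gradient q z ∈ limSubdiff (fun x => φ x + (q x : EReal)) z := by
  obtain ⟨hz, x, w, hx, hφx, hw, hwv⟩ := hv
  refine ⟨EReal.add_lt_top hz.ne (EReal.coe_ne_top _), x, fun n => w n + gradient q (x n), hx, ?_,
    fun n => add_mem_frechetSubdiff (hw n) (hq.differentiable one_ne_zero _).hasGradientAt,
    hwv.add (((continuous_gradient hq).tendsto z).comp hx)⟩
  exact (EReal.continuousAt_add (Or.inr (EReal.coe_ne_bot _)) (Or.inr (EReal.coe_ne_top _))).tendsto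
    |>.comp (hφx.prodMk_nhds (EReal.tendsto_coe.2 ((hq.continuous.tendsto z).comp hx)))

theorem adjoint_mem_frechetSubdiff_comp [CompleteSpace E] {E' : Type*} [NormedAddCommGroup E']
    [InnerProductSpace ℝ E'] [CompleteSpace E'] (T : E' →L[ℝ] E) {p : E'}
    (hv : v ∈ frechetSubdiff φ (T p)) : T.adjoint v ∈ frechetSubdiff (fun q => φ (T q)) p := by
  refine ⟨hv.1, fun ε hε => ?_⟩
  have hT : 0 < ‖T‖ + 1 := by positivity
  filter_upwards [(T.continuous.tendsto p).eventually (hv.2 _ (div_pos hε hT))] with q hq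
  have hT_le : ‖T q - T p‖ ≤ ‖q - p‖ * (‖T‖ + 1) := by
    rw [← map_sub, mul_comm]
    exact (T.le_opNorm _).trans (by gcongr; linarith)
  have hε_le : ε / (‖T‖ + 1) * ‖T q - T p‖ ≤ ε * ‖q - p‖ := by
    rw [div_mul_eq_mul_div, div_le_iff₀ hT, mul_assoc]
    gcongr
  refine le_trans (add_le_add_right (EReal.coe_le_coe_iff.2 ?_) _) hq
  rw [ContinuousLinearMap.adjoint_inner_left, map_sub]
  linarith

end SubdifferentialCalculus

/-! ### Quadratic forms -/

section QuadraticForm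

variable {N : ℕ} {A : Matrix (Fin N) (Fin N) ℝ}

@[simp] theorem sqNorm_zero (A : Matrix (Fin N) (Fin N) ℝ) : sqNorm A 0 = 0 := by
  simp [sqNorm]

theorem sqNorm_smul (A : Matrix (Fin N) (Fin N) ℝ) (t : ℝ) (u : Vec N) :
    sqNorm A (t • u) = t ^ 2 * sqNorm A u := by
  simp only [sqNorm, map_smul, inner_smul_left, inner_smul_right, RCLike.conj_to_real]
  ring

theorem sqNorm_eq_dotProduct (A : Matrix (Fin N) (Fin N) ℝ) (u : Vec N) :
    sqNorm A u = star u.ofLp ⬝ᵥ A.mulVec u.ofLp := by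
  simp [sqNorm, EuclideanSpace.inner_eq_star_dotProduct]

theorem inner_toEuclideanLin_comm (hA : A.IsHermitian) (u v : Vec N) :
    inner ℝ (Matrix.toEuclideanLin A u) v = inner ℝ (Matrix.toEuclideanLin A v) u := by
  rw [Matrix.isSymmetric_toEuclideanLin_iff.2 hA u v, real_inner_comm]

theorem sqNorm_add (hA : A.IsHermitian) (u v : Vec N) :
    sqNorm A (u + v) = sqNorm A u + 2 * inner ℝ (Matrix.toEuclideanLin A u) v + sqNorm A v := by
  simp only [sqNorm, map_add, inner_add_left, inner_add_right, inner_toEuclideanLin_comm hA v u]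
  ring

theorem sqNorm_sub (hA : A.IsHermitian) (u v : Vec N) :
    sqNorm A (u - v) = sqNorm A u - 2 * inner ℝ (Matrix.toEuclideanLin A u) v + sqNorm A v := by
  simp only [sqNorm, map_sub, inner_sub_left, inner_sub_right, inner_toEuclideanLin_comm hA v u]
  ring

theorem sqNorm_nonneg (hA : A.PosSemidef) (u : Vec N) : 0 ≤ sqNorm A u := by
  rw [sqNorm_eq_dotProduct]
  exact hA.dotProduct_mulVec_nonneg _

theorem two_mul_inner_toEuclideanLin_le (hA : A.PosSemidef) (u v : Vec N) :
    2 * inner ℝ (Matrix.toEuclideanLin A u) v ≤ sqNorm A u + sqNorm A v := by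
  linarith [sqNorm_sub hA.isHermitian u v, sqNorm_nonneg hA (u - v)]

theorem mul_norm_sq_le_sqNorm (hA : A.PosSemidef) {c : ℝ} (hc : c ≤ varsigma A) (u : Vec N) :
    c * ‖u‖ ^ 2 ≤ sqNorm A u := by
  rcases eq_or_ne u 0 with rfl | hu
  · simp
  have hpos : 0 < ‖u‖ ^ 2 := by positivity
  rw [← le_div_iff₀ hpos]
  refine hc.trans (csSup_le ⟨0, fun v => ?_⟩ fun b hb => ?_)
  · simpa using sqNorm_nonneg hA v
  · exact (le_div_iff₀ hpos).2 (hb u)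

theorem posDef_of_mul_norm_sq_le_sqNorm (hA : A.IsHermitian) {c : ℝ} (hc : 0 < c)
    (h : ∀ u : Vec N, c * ‖u‖ ^ 2 ≤ sqNorm A u) : A.PosDef := by
  refine Matrix.PosDef.of_dotProduct_mulVec_pos hA fun u hu => ?_
  have hu' : 0 < ‖WithLp.toLp 2 u‖ := norm_pos_iff.2 (by simpa using hu)
  have hu_le := h (WithLp.toLp 2 u)
  rw [sqNorm_eq_dotProduct] at hu_le
  exact lt_of_lt_of_le (by positivity) hu_le

theorem sqNorm_le_norm_sq (hA : (1 - A).PosSemidef) (u : Vec N) : sqNorm A u ≤ ‖u‖ ^ 2 := by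
  have h := sqNorm_nonneg hA u
  rw [sqNorm, map_sub, LinearMap.sub_apply, inner_sub_left] at h
  simpa [sqNorm] using h

theorem norm_toEuclideanLin_le (hA : A.PosSemidef) (hA₁ : (1 - A).PosSemidef) (u : Vec N) :
    ‖Matrix.toEuclideanLin A u‖ ≤ ‖u‖ := by
  refine (sq_le_sq₀ (norm_nonneg _) (norm_nonneg _)).1 ?_
  have h := two_mul_inner_toEuclideanLin_le hA u (Matrix.toEuclideanLin A u)
  rw [real_inner_self_eq_norm_sq] at h
  linarith [sqNorm_le_norm_sq hA₁ u, sqNorm_le_norm_sq hA₁ (Matrix.toEuclideanLin A u)]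

theorem abs_entry_le_one (hA : A.PosSemidef) (hA₁ : (1 - A).PosSemidef) (i j : Fin N) :
    |A i j| ≤ 1 := calc
  |A i j| = ‖Matrix.toEuclideanLin A (EuclideanSpace.single j 1) i‖ := by
    simp [Matrix.toEuclideanLin]
  _ ≤ ‖Matrix.toEuclideanLin A (EuclideanSpace.single j 1)‖ := PiLp.norm_apply_le _ i
  _ ≤ ‖EuclideanSpace.single j (1 : ℝ)‖ := norm_toEuclideanLin_le hA hA₁ _
  _ = 1 := by simp

theorem hasGradientAt_sqNorm_sub (hA : A.IsHermitian) (y z : Vec N) :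
    HasGradientAt (fun z => sqNorm A (z - y)) ((2 : ℝ) • Matrix.toEuclideanLin A (z - y)) z := by
  have hsub : HasFDerivAt (fun z : Vec N => z - y) (ContinuousLinearMap.id ℝ (Vec N)) z :=
    (hasFDerivAt_id z).sub_const y
  have hlin := (Matrix.toEuclideanLin A).toContinuousLinearMap.hasFDerivAt.comp z hsub
  rw [hasGradientAt_iff_hasFDerivAt]
  refine (hlin.inner ℝ hsub).congr_fderiv (ContinuousLinearMap.ext fun r => ?_)
  simp [fderivInnerCLM_apply, inner_sub_left, inner_toEuclideanLin_comm hA r, two_mul]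

end QuadraticForm

/-! ### Semi-convexity -/

section SemiConvexity

theorem IsConvexFun.add_convexOn {E : Type*} [NormedAddCommGroup E] [InnerProductSpace ℝ E]
    {φ : E → EReal} {q : E → ℝ} (hφ : IsConvexFun φ) (hq : ConvexOn ℝ Set.univ q) :
    IsConvexFun fun x => φ x + (q x : EReal) := by
  have hepi (x : E) (r : ℝ) :
      φ x + (q x : EReal) ≤ (r : EReal) ↔ φ x ≤ ((r - q x : ℝ) : EReal) := by
    rw [EReal.coe_sub, EReal.le_sub_iff_add_le (Or.inl (EReal.coe_ne_bot _))
      (Or.inl (EReal.coe_ne_top _))]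
  rintro ⟨x, r⟩ hx ⟨y, s⟩ hy a b ha hb hab
  have hφxy := hφ (x := (x, r - q x)) ((hepi x r).1 hx) (y := (y, s - q y)) ((hepi y s).1 hy)
    ha hb hab
  have hqxy := hq.2 (Set.mem_univ x) (Set.mem_univ y) ha hb hab
  refine (hepi (a • x + b • y) (a • r + b • s)).2
    (le_trans hφxy (EReal.coe_le_coe_iff.2 ?_))
  simp only [Prod.smul_mk, Prod.mk_add_mk, smul_eq_mul] at hqxy ⊢
  linarith

variable {N : ℕ} {f : Vec N → ℝ} {g : Vec N → EReal} {A : Matrix (Fin N) (Fin N) ℝ} {m : ℝ}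

theorem add_one_div_mem_semiConvexModuli_model (hA : A.IsHermitian) (u y : Vec N) (a : ℝ)
    (hm : m ∈ semiConvexModuli g A) : m + 1 / a ∈ semiConvexModuli (model f g u y a A) A := by
  have haff : ConvexOn ℝ Set.univ fun z : Vec N => inner ℝ (gradient f u) (z - u) +
      1 / (2 * a) * (sqNorm A y - 2 * inner ℝ (Matrix.toEuclideanLin A y) z) := by
    refine ⟨convex_univ, fun z _ w _ s t _ _ hst => le_of_eq ?_⟩
    obtain rfl : s = 1 - t := by linarith
    simp only [inner_sub_right, inner_add_right, inner_smul_right, smul_eq_mul]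
    ring
  have hconv := IsConvexFun.add_convexOn (φ := fun z => g z - ((m / 2 * sqNorm A z : ℝ) : EReal))
    hm haff
  rw [semiConvexModuli, Set.mem_ofPred_eq]
  convert hconv using 2 with z
  rw [model, sub_eq_add_neg (g z + _), sub_eq_add_neg (g z), add_assoc, add_assoc, ← EReal.coe_neg,
    ← EReal.coe_neg, ← EReal.coe_add, ← EReal.coe_add, sqNorm_sub hA,
    inner_toEuclideanLin_comm hA z y]
  congr 2
  ring

theorem add_half_mul_sqNorm_le_of_forall_le {φ : Vec N → EReal} (hA : A.IsHermitian)
    (hm : m ∈ semiConvexModuli φ A) {z w : Vec N} (hmin : ∀ w, φ z ≤ φ w) {r s : ℝ}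
    (hz : φ z = r) (hw : φ w = s) : r + m / 2 * sqNorm A (w - z) ≤ s := by
  have hseg (t : ℝ) (ht : t ∈ Set.Ioc (0 : ℝ) 1) :
      r + m / 2 * sqNorm A (w - z) * (1 - t) ≤ s := by
    have hepi : φ (z + t • (w - z)) - ((m / 2 * sqNorm A (z + t • (w - z)) : ℝ) : EReal) ≤
        (((1 - t) * (r - m / 2 * sqNorm A z) + t * (s - m / 2 * sqNorm A w) : ℝ) : EReal) := by
      have hc := hm (x := (z, r - m / 2 * sqNorm A z)) (by simp [hz])
        (y := (w, s - m / 2 * sqNorm A w)) (by simp [hw]) (sub_nonneg.2 ht.2) ht.1.le (by ring)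
      have hpt : (1 - t) • z + t • w = z + t • (w - z) := by module
      simpa only [Set.mem_ofPred_eq, Prod.smul_mk, Prod.mk_add_mk, hpt, smul_eq_mul] using hc
    rw [EReal.sub_le_iff_le_add (Or.inl (EReal.coe_ne_bot _)) (Or.inl (EReal.coe_ne_top _)),
      ← EReal.coe_add] at hepi
    have hle := hz.symm.le.trans ((hmin _).trans hepi)
    have hw_eq : w = z + (w - z) := by abel
    have hsq := sqNorm_add hA z (w - z)
    rw [← hw_eq] at hsq
    rw [EReal.coe_le_coe_iff, sqNorm_add hA, sqNorm_smul, inner_smul_right, hsq] at hle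
    refine le_of_mul_le_mul_left ?_ ht.1
    linarith
  refine le_of_tendsto (x := 𝓝[>] 0) ?_ (mem_of_superset (Ioc_mem_nhdsGT one_pos) hseg)
  have hcont : Continuous fun t : ℝ => r + m / 2 * sqNorm A (w - z) * (1 - t) := by fun_prop
  simpa using (hcont.tendsto 0).mono_left nhdsWithin_le_nhds

end SemiConvexity

/-! ### One step of the algorithm -/

section Model

theorem hasGradientAt_inner_sub {E : Type*} [NormedAddCommGroup E] [InnerProductSpace ℝ E]
    [CompleteSpace E] (c u z : E) : HasGradientAt (fun z => inner ℝ c (z - u)) c z := by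
  rw [hasGradientAt_iff_hasFDerivAt]
  exact ((InnerProductSpace.toDual ℝ E c).hasFDerivAt (x := z - u)).comp z
    ((hasFDerivAt_id z).sub_const u)

variable {N : ℕ} {f : Vec N → ℝ} {g : Vec N → EReal} {u y z : Vec N} {a : ℝ}
  {A : Matrix (Fin N) (Fin N) ℝ}

theorem objective_eq_add (f : Vec N → ℝ) (g : Vec N → EReal) :
    objective f g = fun x => g x + (f x : EReal) :=
  funext fun _ => add_comm _ _

theorem lowerSemicontinuous_objective (hf : Continuous f) (hg : LowerSemicontinuous g) :
    LowerSemicontinuous (objective f g) :=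
  (continuous_coe_real_ereal.comp hf).lowerSemicontinuous.add' hg fun _ =>
    EReal.continuousAt_add (Or.inl (EReal.coe_ne_top _)) (Or.inl (EReal.coe_ne_bot _))

theorem objective_eq_coe (hz : z ∈ effDom g) (hg : g z ≠ ⊥) :
    objective f g z = ((f z + (g z).toReal : ℝ) : EReal) := by
  rw [objective, EReal.coe_add, EReal.coe_toReal hz.ne hg]

theorem model_eq_coe (hz : z ∈ effDom g) (hg : g z ≠ ⊥) :
    model f g u y a A z = (((g z).toReal +
      (inner ℝ (gradient f u) (z - u) + 1 / (2 * a) * sqNorm A (z - y)) : ℝ) : EReal) := by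
  rw [model, EReal.coe_add _ (_ + _), EReal.coe_toReal hz.ne hg]

theorem mem_frechetSubdiff_of_forall_model_le (hA : A.IsHermitian) (hz : z ∈ effDom g)
    (hmin : ∀ w, model f g u y a A z ≤ model f g u y a A w) :
    -(gradient f u + (1 / a) • Matrix.toEuclideanLin A (z - y)) ∈ frechetSubdiff g z := by
  have hzero : 0 ∈ frechetSubdiff (model f g u y a A) z :=
    zero_mem_frechetSubdiff_of_forall_le (EReal.add_lt_top hz.ne (EReal.coe_ne_top _)) hmin
  have hgrad : HasGradientAt
      (fun z => -(inner ℝ (gradient f u) (z - u) + 1 / (2 * a) * sqNorm A (z - y)))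
      (-(gradient f u + (1 / a) • Matrix.toEuclideanLin A (z - y))) z := by
    have hhalf : 1 / a = 1 / (2 * a) * 2 := by ring
    rw [hasGradientAt_iff_hasFDerivAt, hhalf, mul_smul]
    refine ((hasGradientAt_inner_sub (gradient f u) u z).hasFDerivAt.add
      ((hasGradientAt_sqNorm_sub hA y z).hasFDerivAt.const_mul (1 / (2 * a)))).neg.congr_fderiv ?_
    simp only [map_neg, map_add, map_smul]
  have hmem := add_mem_frechetSubdiff hzero hgrad
  rw [zero_add] at hmem
  convert hmem using 2
  funext w
  rw [model, add_assoc, ← EReal.coe_add, add_neg_cancel, EReal.coe_zero, add_zero]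

theorem isCriticalPoint_of_neg_gradient_mem_limSubdiff (hf : ContDiff ℝ 1 f)
    (hu : -gradient f u ∈ limSubdiff g u) : IsCriticalPoint (objective f g) u := by
  have hmem := add_gradient_mem_limSubdiff hu hf
  rw [neg_add_cancel, ← objective_eq_add] at hmem
  exact ⟨hmem.1, hmem⟩

end Model

namespace IsVMiPiano

variable {N : ℕ} {f : Vec N → ℝ} {g : Vec N → EReal} {σ : ℝ} {α β : ℕ → ℝ}
  {A : ℕ → Matrix (Fin N) (Fin N) ℝ} {L m : ℕ → ℝ} {x : ℕ → Vec N}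

local notation "δ" => deltaPar σ α β L m
local notation "γ" => gammaPar σ α β L m

theorem mem_effDom (hx : IsVMiPiano f g σ α β A L m x) : ∀ n, x n ∈ effDom g
  | 0 => (lt_top_iff_ne_top (a := g (x 0))).2 fun h => by
    have hstart := hx.start
    simp [effDom, objective, h] at hstart
  | n + 1 => (lt_top_iff_ne_top (a := g (x (n + 1)))).2 fun h => by
    have hle := hx.update n (x 0)
    rw [model, h, EReal.top_add_coe, top_le_iff, model] at hle
    exact (EReal.add_lt_top (hx.mem_effDom 0).ne (EReal.coe_ne_top _)).ne hle

theorem sigma_le_one (hx : IsVMiPiano f g σ α β A L m x) : σ ≤ 1 := by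
  rcases hx.flag with ⟨-, rfl⟩ | ⟨-, rfl⟩
  exacts [le_rfl, zero_le_one]

theorem exists_pos_le_delta (hx : IsVMiPiano f g σ α β A L m x) :
    ∃ c : ℝ, 0 < c ∧ ∀ n, c ≤ δ n := by
  obtain ⟨c, hc, hγ⟩ := hx.gamma_inf
  refine ⟨c, hc, fun n => ?_⟩
  have hβα : 0 ≤ β n / (2 * α n) :=
    div_nonneg (hx.beta_nonneg n) (mul_pos two_pos (hx.alpha_pos n)).le
  have hγn := hγ n
  rw [gammaPar] at hγn
  linarith

theorem delta_mul_sqNorm_nonneg (hx : IsVMiPiano f g σ α β A L m x) (n : ℕ) (u : Vec N) :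
    0 ≤ δ n * sqNorm (A n) u := by
  obtain ⟨c, hc, hδ⟩ := hx.exists_pos_le_delta
  exact mul_nonneg (hc.le.trans (hδ n)) (sqNorm_nonneg (hx.metric_posDef n).posSemidef u)

theorem delta_le (hx : IsVMiPiano f g σ α β A L m x) (n : ℕ) :
    δ n ≤ 1 / α n - β n / (2 * α n) := by
  have hσ : σ * (1 / α n) ≤ 1 * (1 / α n) :=
    mul_le_mul_of_nonneg_right hx.sigma_le_one (one_div_pos.2 (hx.alpha_pos n)).le
  rw [deltaPar]
  linear_combination (hσ + hx.L_gt n) / 2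

theorem delta_le_one_div_alpha (hx : IsVMiPiano f g σ α β A L m x) (n : ℕ) : δ n ≤ 1 / α n :=
  (hx.delta_le n).trans (sub_le_self _
    (div_nonneg (hx.beta_nonneg n) (mul_pos two_pos (hx.alpha_pos n)).le))

theorem beta_le_one (hx : IsVMiPiano f g σ α β A L m x) (n : ℕ) : β n ≤ 1 := by
  obtain ⟨c, hc, hγ⟩ := hx.gamma_inf
  have hγn := hc.trans_le (hγ n)
  have hδn := hx.delta_le n
  rw [gammaPar] at hγn
  have hpos : 0 < (1 - β n) / α n := by linear_combination hγn + hδn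
  linarith [(div_pos_iff_of_pos_right (hx.alpha_pos n)).1 hpos]

theorem norm_sub_extrapolate_le (hx : IsVMiPiano f g σ α β A L m x) (n : ℕ) (v : Vec N) :
    ‖v - extrapolate β x n‖ ≤ ‖v - x n‖ + ‖x n - x (n - 1)‖ := calc
  ‖v - extrapolate β x n‖ = ‖(v - x n) - β n • (x n - x (n - 1))‖ := by
    rw [extrapolate, sub_add_eq_sub_sub]
  _ ≤ ‖v - x n‖ + β n * ‖x n - x (n - 1)‖ := by
    refine (norm_sub_le _ _).trans_eq ?_
    rw [norm_smul, Real.norm_of_nonneg (hx.beta_nonneg n)]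
  _ ≤ ‖v - x n‖ + ‖x n - x (n - 1)‖ := by
    gcongr
    exact mul_le_of_le_one_left (norm_nonneg _) (hx.beta_le_one n)

theorem update_toReal_le (hx : IsVMiPiano f g σ α β A L m x) (hg : ∀ x, g x ≠ ⊥) (n : ℕ)
    {w : Vec N} (hw : w ∈ effDom g) :
    (g (x (n + 1))).toReal + (inner ℝ (gradient f (x n)) (x (n + 1) - x n) +
        1 / (2 * α n) * sqNorm (A n) (x (n + 1) - extrapolate β x n)) ≤
      (g w).toReal + (inner ℝ (gradient f (x n)) (w - x n) +
        1 / (2 * α n) * sqNorm (A n) (w - extrapolate β x n)) := by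
  have hle := hx.update n w
  rwa [model_eq_coe (hx.mem_effDom _) (hg _), model_eq_coe hw (hg _), EReal.coe_le_coe_iff] at hle

theorem update_toReal_le_of_le_alpha (hx : IsVMiPiano f g σ α β A L m x) (hg : ∀ x, g x ≠ ⊥) {a : ℝ}
    (ha : 0 < a) {n : ℕ} (hα : a ≤ α n) {w : Vec N} (hw : w ∈ effDom g) :
    (g (x (n + 1))).toReal ≤ (g w).toReal + inner ℝ (gradient f (x n)) (w - x (n + 1)) +
      1 / (2 * a) * (‖w - x n‖ + ‖x n - x (n - 1)‖) ^ 2 := by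
  have hmin := hx.update_toReal_le hg n hw
  have hα₂ : 0 ≤ 1 / (2 * α n) := (one_div_pos.2 (mul_pos two_pos (hx.alpha_pos n))).le
  have hnonneg : 0 ≤ 1 / (2 * α n) * sqNorm (A n) (x (n + 1) - extrapolate β x n) :=
    mul_nonneg hα₂ (sqNorm_nonneg (hx.metric_posDef n).posSemidef _)
  have hprox : 1 / (2 * α n) * sqNorm (A n) (w - extrapolate β x n) ≤
      1 / (2 * a) * (‖w - x n‖ + ‖x n - x (n - 1)‖) ^ 2 := by
    gcongr
    · exact sqNorm_nonneg (hx.metric_posDef n).posSemidef _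
    · exact (sqNorm_le_norm_sq (hx.metric_le_one n) _).trans
        (pow_le_pow_left₀ (norm_nonneg _) (hx.norm_sub_extrapolate_le n w) 2)
  have hinner : inner ℝ (gradient f (x n)) (w - x (n + 1)) =
      inner ℝ (gradient f (x n)) (w - x n) - inner ℝ (gradient f (x n)) (x (n + 1) - x n) := by
    rw [← inner_sub_right, sub_sub_sub_cancel_right]
  linarith

theorem update_toReal_add_le (hx : IsVMiPiano f g σ α β A L m x) (hg : ∀ x, g x ≠ ⊥) (n : ℕ)
    {w : Vec N} (hw : w ∈ effDom g) :
    (g (x (n + 1))).toReal + (inner ℝ (gradient f (x n)) (x (n + 1) - x n) +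
        1 / (2 * α n) * sqNorm (A n) (x (n + 1) - extrapolate β x n)) +
      σ * ((m n + 1 / α n) / 2 * sqNorm (A n) (w - x (n + 1))) ≤
      (g w).toReal + (inner ℝ (gradient f (x n)) (w - x n) +
        1 / (2 * α n) * sqNorm (A n) (w - extrapolate β x n)) := by
  rcases hx.flag with ⟨-, rfl⟩ | ⟨-, rfl⟩
  · have hA := (hx.metric_posDef n).isHermitian
    have hm := add_one_div_mem_semiConvexModuli_model (f := f) hA (x n) (extrapolate β x n) (α n)
      (hx.modulus rfl n).1
    rw [one_mul]
    exact add_half_mul_sqNorm_le_of_forall_le hA hm (hx.update n)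
      (model_eq_coe (hx.mem_effDom _) (hg _)) (model_eq_coe hw (hg _))
  · simpa only [zero_mul, add_zero] using hx.update_toReal_le hg n hw

theorem one_step_descent (hx : IsVMiPiano f g σ α β A L m x) (hg : ∀ x, g x ≠ ⊥) (n : ℕ) :
    f (x (n + 1)) + (g (x (n + 1))).toReal + δ n * sqNorm (A n) (x (n + 1) - x n) ≤
      f (x n) + (g (x n)).toReal + (δ n - γ n) * sqNorm (A n) (x n - x (n - 1)) := by
  have hA := hx.metric_posDef n
  have hmin := hx.update_toReal_add_le hg n (hx.mem_effDom n)
  have hstep : x (n + 1) - extrapolate β x n =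
      (x (n + 1) - x n) - β n • (x n - x (n - 1)) := by
    rw [extrapolate, sub_add_eq_sub_sub]
  have hext : x n - extrapolate β x n = (-β n) • (x n - x (n - 1)) := by
    rw [extrapolate]
    module
  have hback : x n - x (n + 1) = (-1 : ℝ) • (x (n + 1) - x n) := by module
  rw [hstep, hext, hback, sub_self, inner_zero_right, sqNorm_sub hA.isHermitian, sqNorm_smul,
    sqNorm_smul, sqNorm_smul, inner_smul_right] at hmin
  have hcross : β n / (2 * α n) *
      (2 * inner ℝ (Matrix.toEuclideanLin (A n) (x (n + 1) - x n)) (x n - x (n - 1))) ≤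
      β n / (2 * α n) * (sqNorm (A n) (x (n + 1) - x n) + sqNorm (A n) (x n - x (n - 1))) :=
    mul_le_mul_of_nonneg_left (two_mul_inner_toEuclideanLin_le hA.posSemidef _ _)
      (div_nonneg (hx.beta_nonneg n) (mul_pos two_pos (hx.alpha_pos n)).le)
  rw [gammaPar, deltaPar]
  linear_combination hmin + hx.majorize n + hcross

theorem exists_mem_frechetSubdiff_norm_add_gradient_le (hx : IsVMiPiano f g σ α β A L m x)
    {K : NNReal} (hf : LipschitzOnWith K (gradient f) (Set.range x)) :
    ∃ B : ℝ, ∀ n, ∃ v ∈ frechetSubdiff g (x (n + 1)),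
      ‖v + gradient f (x (n + 1))‖ ≤ B * (‖x (n + 1) - x n‖ + ‖x n - x (n - 1)‖) := by
  obtain ⟨a, ha, hα⟩ := hx.alpha_inf
  refine ⟨K + 1 / a, fun n => ⟨_, mem_frechetSubdiff_of_forall_model_le
    (hx.metric_posDef n).isHermitian (hx.mem_effDom (n + 1)) (hx.update n), ?_⟩⟩
  have hgrad : ‖gradient f (x (n + 1)) - gradient f (x n)‖ ≤ K * ‖x (n + 1) - x n‖ :=
    hf.norm_sub_le (Set.mem_range_self _) (Set.mem_range_self _)
  have hprox : ‖(1 / α n) • Matrix.toEuclideanLin (A n) (x (n + 1) - extrapolate β x n)‖ ≤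
      1 / a * (‖x (n + 1) - x n‖ + ‖x n - x (n - 1)‖) := by
    rw [norm_smul, Real.norm_of_nonneg (one_div_pos.2 (hx.alpha_pos n)).le]
    gcongr
    · exact hα n
    · exact (norm_toEuclideanLin_le (hx.metric_posDef n).posSemidef (hx.metric_le_one n) _).trans
        (hx.norm_sub_extrapolate_le n _)
  have hsplit : -(gradient f (x n) +
        (1 / α n) • Matrix.toEuclideanLin (A n) (x (n + 1) - extrapolate β x n)) +
      gradient f (x (n + 1)) = (gradient f (x (n + 1)) - gradient f (x n)) -
        (1 / α n) • Matrix.toEuclideanLin (A n) (x (n + 1) - extrapolate β x n) := by abel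
  rw [hsplit]
  linarith [norm_sub_le (gradient f (x (n + 1)) - gradient f (x n))
    ((1 / α n) • Matrix.toEuclideanLin (A n) (x (n + 1) - extrapolate β x n)),
    mul_nonneg K.coe_nonneg (norm_nonneg (x n - x (n - 1)))]

end IsVMiPiano

/-! ### Subgradients of the Lyapunov function -/

section Coupling

variable {E V : Type*} [NormedAddCommGroup E] [InnerProductSpace ℝ E] [CompleteSpace E]
  [NormedAddCommGroup V] [InnerProductSpace ℝ V]

theorem exists_hasGradientAt_inner_apply {T : E → V →L[ℝ] V} {p : E} (hT : DifferentiableAt ℝ T p)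
    (U : E →L[ℝ] V) : ∃ w, HasGradientAt (fun q => inner ℝ (T q (U q)) (U q)) w p ∧
      ‖w‖ ≤ (‖fderiv ℝ T p‖ * ‖U p‖ + 2 * (‖T p‖ * ‖U‖)) * ‖U p‖ := by
  have hd := (hT.hasFDerivAt.clm_apply U.hasFDerivAt).inner ℝ U.hasFDerivAt
  refine ⟨(InnerProductSpace.toDual ℝ E).symm _,
    by rwa [hasGradientAt_iff_hasFDerivAt, LinearIsometryEquiv.apply_symm_apply], ?_⟩
  rw [LinearIsometryEquiv.norm_map]
  refine ContinuousLinearMap.opNorm_le_bound _ (by positivity) fun e => ?_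
  have hU := U.le_opNorm e
  have hTU := (T p).le_opNorm_of_le le_rfl (x := U p)
  have hTUe := (T p).le_opNorm_of_le hU
  have hT' := (fderiv ℝ T p e).le_opNorm_of_le le_rfl (x := U p)
  have hT'e := (fderiv ℝ T p).le_opNorm e
  calc ‖inner ℝ (T p (U p)) (U e) + inner ℝ (T p (U e) + fderiv ℝ T p e (U p)) (U p)‖
    _ ≤ ‖T p (U p)‖ * ‖U e‖ + (‖T p (U e)‖ + ‖fderiv ℝ T p e (U p)‖) * ‖U p‖ :=
      (norm_add_le _ _).trans (add_le_add (norm_inner_le_norm _ _) ((norm_inner_le_norm _ _).trans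
        (by gcongr; exact norm_add_le _ _)))
    _ ≤ ‖T p‖ * ‖U p‖ * (‖U‖ * ‖e‖) +
        (‖T p‖ * (‖U‖ * ‖e‖) + ‖fderiv ℝ T p‖ * ‖e‖ * ‖U p‖) * ‖U p‖ := by
      gcongr
      exact hT'.trans (by gcongr)
    _ = (‖fderiv ℝ T p‖ * ‖U p‖ + 2 * (‖T p‖ * ‖U‖)) * ‖U p‖ * ‖e‖ := by ring

theorem exists_hasGradientAt_inner_apply_norm_le [ProperSpace E] {T : E → V →L[ℝ] V}
    (hT : ContDiff ℝ 1 T) (U : E →L[ℝ] V) {s : Set E} (hs : Bornology.IsBounded s) :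
    ∃ C : ℝ, 0 ≤ C ∧ ∀ p ∈ s, ∃ w,
      HasGradientAt (fun q => inner ℝ (T q (U q)) (U q)) w p ∧ ‖w‖ ≤ C * ‖U p‖ := by
  have hcont : Continuous fun p => ‖fderiv ℝ T p‖ * ‖U p‖ + 2 * (‖T p‖ * ‖U‖) := by
    have hT' := hT.continuous_fderiv one_ne_zero
    exact (hT'.norm.mul U.continuous.norm).add
      (continuous_const.mul (hT.continuous.norm.mul continuous_const))
  obtain ⟨C, hC⟩ := hs.isCompact_closure.exists_bound_of_continuousOn hcont.continuousOn
  refine ⟨max C 0, le_max_right _ _, fun p hp => ?_⟩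
  obtain ⟨w, hw, hle⟩ :=
    exists_hasGradientAt_inner_apply (hT.differentiable one_ne_zero p) U
  exact ⟨w, hw, hle.trans (by
    gcongr
    exact (Real.le_norm_self _).trans ((hC p (subset_closure hp)).trans (le_max_left _ _)))⟩

end Coupling

section Lyapunov

variable {N : ℕ} {f : Vec N → ℝ} {g : Vec N → EReal}

namespace LyapSpace

/-- The coordinates `(A, δ)`, on which `matPart` and `deltaPart` depend. -/
noncomputable def parL (N : ℕ) :
    LyapSpace N →L[ℝ] WithLp 2 (EuclideanSpace ℝ (Fin N × Fin N) × ℝ) :=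
  (WithLp.sndL 2 ℝ (Vec N) _).comp (WithLp.sndL 2 ℝ (Vec N) _)

/-- `xPart` as a continuous linear map. -/
noncomputable def xPartL (N : ℕ) : LyapSpace N →L[ℝ] Vec N :=
  WithLp.fstL 2 ℝ (Vec N) _

/-- `yPart` as a continuous linear map. -/
noncomputable def yPartL (N : ℕ) : LyapSpace N →L[ℝ] Vec N :=
  (WithLp.fstL 2 ℝ (Vec N) _).comp (WithLp.sndL 2 ℝ (Vec N) _)

/-- `deltaPart` as a continuous linear map. -/
noncomputable def deltaPartL (N : ℕ) : LyapSpace N →L[ℝ] ℝ :=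
  (WithLp.sndL 2 ℝ (EuclideanSpace ℝ (Fin N × Fin N)) ℝ).comp (parL N)

/-- The operator on `ℝ^N` with the given matrix entries. -/
noncomputable def entriesOperator (N : ℕ) :
    EuclideanSpace ℝ (Fin N × Fin N) →ₗ[ℝ] Vec N →L[ℝ] Vec N where
  toFun a := (Matrix.toEuclideanLin (Matrix.of fun i j => a (i, j))).toContinuousLinearMap
  map_add' a b := by
    rw [← map_add, ← map_add]
    rfl
  map_smul' c a := by
    rw [← map_smul, ← map_smul]
    rfl

/-- `matPart` as an operator on `ℝ^N` that depends linearly on the point. -/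
noncomputable def matOperatorL (N : ℕ) : LyapSpace N →L[ℝ] Vec N →L[ℝ] Vec N :=
  (entriesOperator N).toContinuousLinearMap.comp
    ((WithLp.fstL 2 ℝ (EuclideanSpace ℝ (Fin N × Fin N)) ℝ).comp (parL N))

theorem norm_xPartL_le : ‖xPartL N‖ ≤ 1 :=
  (xPartL N).opNorm_le_bound zero_le_one fun p =>
    (WithLp.norm_fst_le _ p).trans (one_mul _).ge

theorem continuous_matPart : Continuous (matPart : LyapSpace N → Matrix (Fin N) (Fin N) ℝ) :=
  continuous_matrix fun i j => (EuclideanSpace.proj (𝕜 := ℝ) (i, j)).continuous.comp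
    ((WithLp.fstL 2 ℝ (EuclideanSpace ℝ (Fin N × Fin N)) ℝ).comp (parL N)).continuous

end LyapSpace

open LyapSpace in
theorem exists_mem_frechetSubdiff_lyapunov {s : Set (LyapSpace N)} (hs : Bornology.IsBounded s) :
    ∃ C : ℝ, 0 ≤ C ∧ ∀ p ∈ s, ∀ v ∈ frechetSubdiff (objective f g) p.xPart,
      ∃ w ∈ frechetSubdiff (lyapunov f g) p, ‖w‖ ≤ ‖v‖ + C * ‖p.xPart - p.yPart‖ := by
  have hcoupling : (fun p : LyapSpace N => p.deltaPart * sqNorm p.matPart (p.xPart - p.yPart)) =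
      fun p => inner ℝ ((deltaPartL N p • matOperatorL N p) ((xPartL N - yPartL N) p))
        ((xPartL N - yPartL N) p) :=
    funext fun p => (real_inner_smul_left _ _ _).symm
  obtain ⟨C, hC, hgrad⟩ := exists_hasGradientAt_inner_apply_norm_le
    ((deltaPartL N).contDiff.smul (matOperatorL N).contDiff) (xPartL N - yPartL N) hs
  refine ⟨C, hC, fun p hp v hv => ?_⟩
  obtain ⟨w, hw, hle⟩ := hgrad p hp
  have hadj : ‖(xPartL N).adjoint v‖ ≤ ‖v‖ :=
    ((xPartL N).adjoint.le_opNorm v).trans (mul_le_of_le_one_left (norm_nonneg v)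
      ((LinearIsometryEquiv.norm_map _ _).trans_le norm_xPartL_le))
  exact ⟨_, add_mem_frechetSubdiff (adjoint_mem_frechetSubdiff_comp (xPartL N) hv)
    (hcoupling ▸ hw), (norm_add_le _ _).trans (add_le_add hadj hle)⟩

/-- The entries of a matrix, as a vector of the Euclidean space that carries the `A`-component
of a `LyapSpace`. -/
noncomputable def entries (A : Matrix (Fin N) (Fin N) ℝ) : EuclideanSpace ℝ (Fin N × Fin N) :=
  WithLp.toLp 2 fun ij => A ij.1 ij.2

theorem norm_entries_le {A : Matrix (Fin N) (Fin N) ℝ} (hA : A.PosSemidef)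
    (hA₁ : (1 - A).PosSemidef) : ‖entries A‖ ≤ N := by
  refine abs_le_of_sq_le_sq' ?_ (Nat.cast_nonneg N) |>.2
  calc ‖entries A‖ ^ 2 = ∑ ij, ‖entries A ij‖ ^ 2 := EuclideanSpace.norm_sq_eq _
    _ ≤ ∑ _ij : Fin N × Fin N, (1 : ℝ) := Finset.sum_le_sum fun ij _ =>
      pow_le_one₀ (norm_nonneg _) (abs_entry_le_one hA hA₁ ij.1 ij.2)
    _ = (N : ℝ) ^ 2 := by simp [sq]

theorem norm_toLp_prod_le {E E' : Type*} [NormedAddCommGroup E] [NormedAddCommGroup E']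
    (a : E) (b : E') : ‖WithLp.toLp 2 (a, b)‖ ≤ ‖a‖ + ‖b‖ := by
  refine abs_le_of_sq_le_sq' ?_ (by positivity) |>.2
  rw [WithLp.prod_norm_sq_eq_of_L2, add_sq]
  simp only [WithLp.toLp_fst, WithLp.toLp_snd]
  linarith [mul_nonneg (norm_nonneg a) (norm_nonneg b)]

/-- The point `(x, y, A, δ)` of the space on which the Lyapunov function is defined. -/
noncomputable def lyapPoint (x y : Vec N) (A : Matrix (Fin N) (Fin N) ℝ) (δ : ℝ) : LyapSpace N :=
  WithLp.toLp 2 (x, WithLp.toLp 2 (y, WithLp.toLp 2 (entries A, δ)))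

theorem norm_lyapPoint_le (x y : Vec N) (A : Matrix (Fin N) (Fin N) ℝ) (δ : ℝ) :
    ‖lyapPoint x y A δ‖ ≤ ‖x‖ + (‖y‖ + (‖entries A‖ + |δ|)) := by
  refine (norm_toLp_prod_le _ _).trans ?_
  gcongr
  refine (norm_toLp_prod_le _ _).trans ?_
  gcongr
  exact norm_toLp_prod_le _ _

theorem lyapunov_lyapPoint (x y : Vec N) (A : Matrix (Fin N) (Fin N) ℝ) (δ : ℝ) :
    lyapunov f g (lyapPoint x y A δ) = objective f g x + ((δ * sqNorm A (x - y) : ℝ) : EReal) :=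
  rfl

theorem continuous_sqNorm_left (u : Vec N) :
    Continuous fun A : Matrix (Fin N) (Fin N) ℝ => sqNorm A u := by
  simp only [sqNorm_eq_dotProduct]
  fun_prop

end Lyapunov

/-! ### Asymptotics of the iterates -/

namespace IsVMiPiano

variable {N : ℕ} {f : Vec N → ℝ} {g : Vec N → EReal} {σ : ℝ} {α β : ℕ → ℝ}
  {A : ℕ → Matrix (Fin N) (Fin N) ℝ} {L m : ℕ → ℝ} {x : ℕ → Vec N} {ζ : ℝ} {K : NNReal}

local notation "δ" => deltaPar σ α β L m

/-- The point `(x^{n+1}, x^n, A_{n+1}, δ_{n+1})` at which the Lyapunov function is evaluated. -/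
noncomputable def lyapIterate (σ : ℝ) (α β : ℕ → ℝ) (A : ℕ → Matrix (Fin N) (Fin N) ℝ)
    (L m : ℕ → ℝ) (x : ℕ → Vec N) (n : ℕ) : LyapSpace N :=
  lyapPoint (x (n + 1)) (x n) (A (n + 1)) (deltaPar σ α β L m (n + 1))

/-- The value of the Lyapunov function at `lyapIterate`, as a real number. -/
noncomputable def lyapValue (f : Vec N → ℝ) (g : Vec N → EReal) (σ : ℝ) (α β : ℕ → ℝ)
    (A : ℕ → Matrix (Fin N) (Fin N) ℝ) (L m : ℕ → ℝ) (x : ℕ → Vec N) (n : ℕ) : ℝ :=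
  f (x (n + 1)) + (g (x (n + 1))).toReal +
    deltaPar σ α β L m (n + 1) * sqNorm (A (n + 1)) (x (n + 1) - x n)

local notation "ξ" => lyapIterate σ α β A L m x
local notation "Φ" => lyapValue f g σ α β A L m x

theorem objective_iterate (hx : IsVMiPiano f g σ α β A L m x) (hg : ∀ x, g x ≠ ⊥) (n : ℕ) :
    objective f g (x n) = ((f (x n) + (g (x n)).toReal : ℝ) : EReal) :=
  objective_eq_coe (hx.mem_effDom n) (hg _)

theorem lyapunov_lyapIterate (hx : IsVMiPiano f g σ α β A L m x) (hg : ∀ x, g x ≠ ⊥) (n : ℕ) :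
    lyapunov f g (ξ n) = (Φ n : EReal) := by
  rw [lyapIterate, lyapunov_lyapPoint, hx.objective_iterate hg, lyapValue, ← EReal.coe_add]

theorem le_lyapValue (hx : IsVMiPiano f g σ α β A L m x) (n : ℕ) :
    f (x (n + 1)) + (g (x (n + 1))).toReal ≤ Φ n :=
  le_add_of_nonneg_right (hx.delta_mul_sqNorm_nonneg (n + 1) _)

theorem exists_lyapValue_descent (hx : IsVMiPiano f g σ α β A L m x) (hg : ∀ x, g x ≠ ⊥) :
    ∃ c : ℝ, 0 < c ∧ ∀ n, c * ‖x (n + 1) - x n‖ ^ 2 ≤ Φ n - Φ (n + 1) := by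
  obtain ⟨c, hc, hγ⟩ := hx.gamma_inf
  obtain ⟨c', hc', hA⟩ := hx.metric_inf
  refine ⟨c * c', mul_pos hc hc', fun n => ?_⟩
  have hdescent := hx.one_step_descent hg (n + 1)
  have hquad := mul_le_mul (hγ (n + 1)) (mul_norm_sq_le_sqNorm
    (hx.metric_posDef (n + 1)).posSemidef (hA (n + 1)) (x (n + 1) - x n)) (by positivity)
    (hc.le.trans (hγ (n + 1)))
  rw [Nat.add_sub_cancel] at hdescent
  rw [lyapValue, lyapValue]
  linarith [hx.delta_step (n + 1)]

theorem antitone_lyapValue (hx : IsVMiPiano f g σ α β A L m x) (hg : ∀ x, g x ≠ ⊥) :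
    Antitone Φ := by
  obtain ⟨c, hc, hdescent⟩ := hx.exists_lyapValue_descent hg
  exact antitone_nat_of_succ_le fun n => sub_nonneg.1 (le_trans (by positivity) (hdescent n))

theorem isBounded_range_of_coercive (hx : IsVMiPiano f g σ α β A L m x) (hg : ∀ x, g x ≠ ⊥)
    (hh : Tendsto (objective f g) (cocompact (Vec N)) (𝓝 ⊤)) :
    Bornology.IsBounded (Set.range x) := by
  obtain ⟨s, hs, hsub⟩ :=
    mem_cocompact.1 (hh.eventually (lt_mem_nhds (EReal.coe_lt_top (Φ 0))))
  have hmem : ∀ n, x (n + 1) ∈ s := fun n => by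
    by_contra hn
    have hlt : (Φ 0 : EReal) < objective f g (x (n + 1)) := hsub hn
    rw [hx.objective_iterate hg, EReal.coe_lt_coe_iff] at hlt
    exact hlt.not_ge ((hx.le_lyapValue n).trans (hx.antitone_lyapValue hg n.zero_le))
  refine (hs.isBounded.insert (x 0)).subset ?_
  rintro _ ⟨_ | n, rfl⟩
  exacts [Set.mem_insert _ _, Set.mem_insert_of_mem _ (hmem n)]

theorem exists_tendsto_lyapValue (hx : IsVMiPiano f g σ α β A L m x) (hg : ∀ x, g x ≠ ⊥)
    (hg_lsc : LowerSemicontinuous g) (hf : Continuous f) (hb : Bornology.IsBounded (Set.range x)) :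
    ∃ ζ : ℝ, Tendsto Φ atTop (𝓝 ζ) := by
  obtain ⟨z, -, hz⟩ := ((lowerSemicontinuous_objective hf hg_lsc).lowerSemicontinuousOn _
    ).exists_isMinOn (Set.range_nonempty x).closure hb.isCompact_closure
  have hle : ∀ n, objective f g z ≤ objective f g (x n) := fun n =>
    hz (subset_closure (Set.mem_range_self n))
  have hzdom : z ∈ effDom g := by
    refine (lt_top_iff_ne_top (a := g z)).2 fun htop => (hle 0).not_gt (hx.start.trans_eq ?_)
    rw [objective, htop, EReal.coe_add_top]
  refine ⟨_, tendsto_atTop_ciInf (hx.antitone_lyapValue hg) ⟨f z + (g z).toReal, ?_⟩⟩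
  rintro _ ⟨n, rfl⟩
  have hlen := hle (n + 1)
  rw [objective_eq_coe hzdom (hg z), hx.objective_iterate hg, EReal.coe_le_coe_iff] at hlen
  exact hlen.trans (hx.le_lyapValue n)

theorem tendsto_norm_step (hx : IsVMiPiano f g σ α β A L m x) (hg : ∀ x, g x ≠ ⊥)
    (hζ : Tendsto Φ atTop (𝓝 ζ)) : Tendsto (fun n => ‖x (n + 1) - x n‖) atTop (𝓝 0) := by
  obtain ⟨c, hc, hdescent⟩ := hx.exists_lyapValue_descent hg
  have hdecrease : Tendsto (fun n => (Φ n - Φ (n + 1)) / c) atTop (𝓝 0) := by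
    simpa using (hζ.sub (hζ.comp (tendsto_add_atTop_nat 1))).div_const c
  have hsq : Tendsto (fun n => ‖x (n + 1) - x n‖ ^ 2) atTop (𝓝 0) :=
    squeeze_zero (fun n => by positivity) (fun n => (le_div_iff₀' hc).2 (hdescent n)) hdecrease
  simpa [Real.sqrt_sq] using hsq.sqrt

theorem tendsto_norm_step_add_prev (hx : IsVMiPiano f g σ α β A L m x) (hg : ∀ x, g x ≠ ⊥)
    (hζ : Tendsto Φ atTop (𝓝 ζ)) :
    Tendsto (fun n => ‖x (n + 1) - x n‖ + ‖x n - x (n - 1)‖) atTop (𝓝 0) := by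
  have hstep := hx.tendsto_norm_step hg hζ
  have hprev : Tendsto (fun n => ‖x n - x (n - 1)‖) atTop (𝓝 0) :=
    (tendsto_add_atTop_iff_nat 1).1 (by simpa using hstep)
  simpa using hstep.add hprev

theorem tendsto_objective (hx : IsVMiPiano f g σ α β A L m x) (hg : ∀ x, g x ≠ ⊥)
    (hζ : Tendsto Φ atTop (𝓝 ζ)) :
    Tendsto (fun n => f (x (n + 1)) + (g (x (n + 1))).toReal) atTop (𝓝 ζ) := by
  obtain ⟨a, ha, hα⟩ := hx.alpha_inf
  have hcoupling : Tendsto (fun n => δ (n + 1) * sqNorm (A (n + 1)) (x (n + 1) - x n)) atTop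
      (𝓝 0) := by
    refine squeeze_zero (g := fun n => 1 / a * ‖x (n + 1) - x n‖ ^ 2)
      (fun n => hx.delta_mul_sqNorm_nonneg _ _) (fun n => ?_) ?_
    · exact mul_le_mul
        ((hx.delta_le_one_div_alpha _).trans (one_div_le_one_div_of_le ha (hα _)))
        (sqNorm_le_norm_sq (hx.metric_le_one _) _)
        (sqNorm_nonneg (hx.metric_posDef _).posSemidef _) (one_div_pos.2 ha).le
    · simpa using ((hx.tendsto_norm_step hg hζ).pow 2).const_mul (1 / a)
  simpa [lyapValue] using hζ.sub hcoupling

theorem isBounded_range_lyapIterate (hx : IsVMiPiano f g σ α β A L m x)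
    (hb : Bornology.IsBounded (Set.range x)) : Bornology.IsBounded (Set.range ξ) := by
  obtain ⟨R, hR⟩ := hb.exists_norm_le
  obtain ⟨a, ha, hα⟩ := hx.alpha_inf
  obtain ⟨c, hc, hδ⟩ := hx.exists_pos_le_delta
  refine isBounded_iff_forall_norm_le.2 ⟨R + (R + (N + 1 / a)), ?_⟩
  rintro _ ⟨n, rfl⟩
  refine (norm_lyapPoint_le _ _ _ _).trans ?_
  gcongr
  · exact hR _ (Set.mem_range_self _)
  · exact hR _ (Set.mem_range_self _)
  · exact norm_entries_le (hx.metric_posDef _).posSemidef (hx.metric_le_one _)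
  · rw [abs_of_pos (hc.trans_le (hδ _))]
    exact (hx.delta_le_one_div_alpha _).trans (one_div_le_one_div_of_le ha (hα _))

theorem exists_mem_frechetSubdiff_lyapIterate (hx : IsVMiPiano f g σ α β A L m x)
    (hf : Differentiable ℝ f) (hK : LipschitzOnWith K (gradient f) (Set.range x))
    (hb : Bornology.IsBounded (Set.range x)) :
    ∃ B : ℝ, ∀ n, ∃ w ∈ frechetSubdiff (lyapunov f g) (ξ n),
      ‖w‖ ≤ B * (‖x (n + 1) - x n‖ + ‖x n - x (n - 1)‖) := by
  obtain ⟨B, hres⟩ := hx.exists_mem_frechetSubdiff_norm_add_gradient_le hK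
  obtain ⟨C, hC, hlyap⟩ := exists_mem_frechetSubdiff_lyapunov (f := f) (g := g)
    (hx.isBounded_range_lyapIterate hb)
  refine ⟨B + C, fun n => ?_⟩
  obtain ⟨v, hv, hvn⟩ := hres n
  have hv' : v + gradient f (x (n + 1)) ∈ frechetSubdiff (objective f g) (x (n + 1)) := by
    rw [objective_eq_add]
    exact add_mem_frechetSubdiff hv (hf (x (n + 1))).hasGradientAt
  obtain ⟨w, hw, hwn⟩ := hlyap _ (Set.mem_range_self n) _ hv'
  have hwn' : ‖w‖ ≤ ‖v + gradient f (x (n + 1))‖ + C * ‖x (n + 1) - x n‖ := hwn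
  refine ⟨w, hw, ?_⟩
  linarith [mul_nonneg hC (norm_nonneg (x n - x (n - 1)))]

end IsVMiPiano

/-! ### Limit points -/

namespace IsVMiPiano

variable {N : ℕ} {f : Vec N → ℝ} {g : Vec N → EReal} {σ : ℝ} {α β : ℕ → ℝ}
  {A : ℕ → Matrix (Fin N) (Fin N) ℝ} {L m : ℕ → ℝ} {x : ℕ → Vec N} {ζ : ℝ} {K : NNReal}
  {l : Filter ℕ} {u : Vec N} {p : LyapSpace N}

local notation "ξ" => lyapIterate σ α β A L m x
local notation "Φ" => lyapValue f g σ α β A L m x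

theorem tendsto_toReal_of_tendsto (hx : IsVMiPiano f g σ α β A L m x) (hg : ∀ x, g x ≠ ⊥)
    (hf : Continuous f) (hζ : Tendsto Φ atTop (𝓝 ζ)) (hl : l ≤ atTop)
    (hu : Tendsto (fun n => x (n + 1)) l (𝓝 u)) :
    Tendsto (fun n => (g (x (n + 1))).toReal) l (𝓝 (ζ - f u)) := by
  simpa [Function.comp_def] using
    ((hx.tendsto_objective hg hζ).mono_left hl).sub ((hf.tendsto u).comp hu)

theorem apply_le_of_tendsto [l.NeBot] (hx : IsVMiPiano f g σ α β A L m x) (hg : ∀ x, g x ≠ ⊥)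
    (hg_lsc : LowerSemicontinuous g) (hf : Continuous f) (hζ : Tendsto Φ atTop (𝓝 ζ))
    (hl : l ≤ atTop) (hu : Tendsto (fun n => x (n + 1)) l (𝓝 u)) :
    g u ≤ ((ζ - f u : ℝ) : EReal) := by
  refine le_of_forall_lt fun c hc => ?_
  obtain ⟨c', hcc', hc'⟩ := exists_between hc
  refine hcc'.trans_le (ge_of_tendsto
    (EReal.tendsto_coe.2 (hx.tendsto_toReal_of_tendsto hg hf hζ hl hu)) ?_)
  filter_upwards [hu.eventually (hg_lsc u c' hc')] with n hn
  rw [EReal.coe_toReal (hx.mem_effDom _).ne (hg _)]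
  exact hn.le

theorem tendsto_of_tendsto_succ (hx : IsVMiPiano f g σ α β A L m x) (hg : ∀ x, g x ≠ ⊥)
    (hζ : Tendsto Φ atTop (𝓝 ζ)) (hl : l ≤ atTop)
    (hu : Tendsto (fun n => x (n + 1)) l (𝓝 u)) : Tendsto x l (𝓝 u) := by
  simpa using hu.sub (tendsto_zero_iff_norm_tendsto_zero.2
    ((hx.tendsto_norm_step hg hζ).mono_left hl))

theorem sub_le_toReal_of_tendsto [l.NeBot] (hx : IsVMiPiano f g σ α β A L m x)
    (hg : ∀ x, g x ≠ ⊥) (hf : ContDiff ℝ 1 f) (hζ : Tendsto Φ atTop (𝓝 ζ)) (hl : l ≤ atTop)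
    (hu : Tendsto (fun n => x (n + 1)) l (𝓝 u)) (hudom : u ∈ effDom g) :
    ζ - f u ≤ (g u).toReal := by
  obtain ⟨a, ha, hα⟩ := hx.alpha_inf
  have hu₀ := hx.tendsto_of_tendsto_succ hg hζ hl hu
  have hinner : Tendsto (fun n => inner ℝ (gradient f (x n)) (u - x (n + 1))) l (𝓝 0) := by
    simpa using (((continuous_gradient hf).tendsto u).comp hu₀).inner (𝕜 := ℝ) (hu.const_sub u)
  have hdist : Tendsto (fun n => ‖u - x n‖ + ‖x n - x (n - 1)‖) l (𝓝 0) := by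
    have hprev : Tendsto (fun n => ‖x n - x (n - 1)‖) l (𝓝 0) :=
      squeeze_zero (fun n => norm_nonneg _)
        (fun n => le_add_of_nonneg_left (norm_nonneg (x (n + 1) - x n)))
        ((hx.tendsto_norm_step_add_prev hg hζ).mono_left hl)
    simpa using (hu₀.const_sub u).norm.add hprev
  have hbound : Tendsto (fun n => (g u).toReal + inner ℝ (gradient f (x n)) (u - x (n + 1)) +
      1 / (2 * a) * (‖u - x n‖ + ‖x n - x (n - 1)‖) ^ 2) l (𝓝 (g u).toReal) := by
    simpa using (hinner.const_add (g u).toReal).add ((hdist.pow 2).const_mul (1 / (2 * a)))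
  exact le_of_tendsto_of_tendsto' (hx.tendsto_toReal_of_tendsto hg hf.continuous hζ hl hu) hbound
    fun n => hx.update_toReal_le_of_le_alpha hg ha (hα n) hudom

theorem apply_eq_of_tendsto [l.NeBot] (hx : IsVMiPiano f g σ α β A L m x) (hg : ∀ x, g x ≠ ⊥)
    (hg_lsc : LowerSemicontinuous g) (hf : ContDiff ℝ 1 f) (hζ : Tendsto Φ atTop (𝓝 ζ))
    (hl : l ≤ atTop) (hu : Tendsto (fun n => x (n + 1)) l (𝓝 u)) :
    g u = ((ζ - f u : ℝ) : EReal) := by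
  have hle := hx.apply_le_of_tendsto hg hg_lsc hf.continuous hζ hl hu
  have hudom : u ∈ effDom g := hle.trans_lt (EReal.coe_lt_top _)
  refine hle.antisymm ?_
  rw [← EReal.coe_toReal hudom.ne (hg u), EReal.coe_le_coe_iff]
  exact hx.sub_le_toReal_of_tendsto hg hf hζ hl hu hudom

theorem neg_gradient_mem_limSubdiff_of_tendsto (hx : IsVMiPiano f g σ α β A L m x)
    (hg : ∀ x, g x ≠ ⊥) (hg_lsc : LowerSemicontinuous g) (hf : ContDiff ℝ 1 f)
    (hK : LipschitzOnWith K (gradient f) (Set.range x)) (hζ : Tendsto Φ atTop (𝓝 ζ))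
    (hu : Tendsto x atTop (𝓝 u)) : -gradient f u ∈ limSubdiff g u := by
  have hu₁ : Tendsto (fun n => x (n + 1)) atTop (𝓝 u) := hu.comp (tendsto_add_atTop_nat 1)
  have hgu := hx.apply_eq_of_tendsto hg hg_lsc hf hζ le_rfl hu₁
  obtain ⟨B, hres⟩ := hx.exists_mem_frechetSubdiff_norm_add_gradient_le hK
  choose v hv hvn using hres
  have hsum : Tendsto (fun n => v n + gradient f (x (n + 1))) atTop (𝓝 0) :=
    squeeze_zero_norm hvn (by simpa using (hx.tendsto_norm_step_add_prev hg hζ).const_mul B)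
  have hgx : Tendsto (fun n => g (x (n + 1))) atTop (𝓝 (g u)) := by
    rw [hgu]
    exact (EReal.tendsto_coe.2
      (hx.tendsto_toReal_of_tendsto hg hf.continuous hζ le_rfl hu₁)).congr
      fun n => EReal.coe_toReal (hx.mem_effDom _).ne (hg _)
  refine ⟨hgu.trans_lt (EReal.coe_lt_top _), fun n => x (n + 1), v, hu₁, hgx, hv, ?_⟩
  simpa using hsum.sub (((continuous_gradient hf).tendsto u).comp hu₁)

theorem mem_lyapRegion_of_tendsto [l.NeBot] (hx : IsVMiPiano f g σ α β A L m x)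
    (hp : Tendsto ξ l (𝓝 p)) : p ∈ LyapRegion N := by
  have hmat : Tendsto (fun n => A (n + 1)) l (𝓝 p.matPart) :=
    (LyapSpace.continuous_matPart.tendsto p).comp hp
  have hherm : p.matPart.IsHermitian :=
    (isClosed_eq continuous_id.matrix_conjTranspose continuous_id).mem_of_tendsto hmat
      (Eventually.of_forall fun n => (hx.metric_posDef (n + 1)).isHermitian)
  obtain ⟨c, hc, hA⟩ := hx.metric_inf
  obtain ⟨c', hc', hδ⟩ := hx.exists_pos_le_delta
  refine ⟨posDef_of_mul_norm_sq_le_sqNorm hherm hc fun u => ?_, hc'.trans_le ?_⟩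
  · exact ge_of_tendsto' (((continuous_sqNorm_left u).tendsto _).comp hmat) fun n =>
      mul_norm_sq_le_sqNorm (hx.metric_posDef (n + 1)).posSemidef (hA _) u
  · exact ge_of_tendsto' (((LyapSpace.deltaPartL N).continuous.tendsto p).comp hp) fun n => hδ _

theorem lyapunov_eq_of_tendsto [l.NeBot] (hx : IsVMiPiano f g σ α β A L m x)
    (hg : ∀ x, g x ≠ ⊥) (hg_lsc : LowerSemicontinuous g) (hf : ContDiff ℝ 1 f)
    (hζ : Tendsto Φ atTop (𝓝 ζ)) (hl : l ≤ atTop) (hp : Tendsto ξ l (𝓝 p)) :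
    lyapunov f g p = (ζ : EReal) := by
  have hX : Tendsto (fun n => x (n + 1)) l (𝓝 p.xPart) :=
    ((LyapSpace.xPartL N).continuous.tendsto p).comp hp
  have hY : Tendsto x l (𝓝 p.yPart) := ((LyapSpace.yPartL N).continuous.tendsto p).comp hp
  have hXY : p.xPart = p.yPart :=
    tendsto_nhds_unique (hx.tendsto_of_tendsto_succ hg hζ hl hX) hY
  rw [lyapunov, objective, hx.apply_eq_of_tendsto hg hg_lsc hf hζ hl hX, hXY, sub_self, sqNorm_zero,
    mul_zero, EReal.coe_zero, add_zero, ← EReal.coe_add, add_sub_cancel]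

theorem zero_mem_limSubdiff_lyapunov_of_tendsto (hx : IsVMiPiano f g σ α β A L m x)
    (hg : ∀ x, g x ≠ ⊥) (hg_lsc : LowerSemicontinuous g) (hf : ContDiff ℝ 1 f)
    (hK : LipschitzOnWith K (gradient f) (Set.range x)) (hb : Bornology.IsBounded (Set.range x))
    (hζ : Tendsto Φ atTop (𝓝 ζ)) {k : ℕ → ℕ} (hk : Tendsto k atTop atTop)
    (hp : Tendsto (fun i => ξ (k i)) atTop (𝓝 p)) : 0 ∈ limSubdiff (lyapunov f g) p := by
  have hF : lyapunov f g p = ζ :=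
    hx.lyapunov_eq_of_tendsto hg hg_lsc hf hζ hk (tendsto_map'_iff.2 hp)
  obtain ⟨B, hsub⟩ := hx.exists_mem_frechetSubdiff_lyapIterate (hf.differentiable one_ne_zero) hK hb
  choose w hw hwn using hsub
  have hw₀ : Tendsto w atTop (𝓝 0) :=
    squeeze_zero_norm hwn (by simpa using (hx.tendsto_norm_step_add_prev hg hζ).const_mul B)
  refine ⟨hF.trans_lt (EReal.coe_lt_top ζ), fun i => ξ (k i), fun i => w (k i), hp, ?_,
    fun i => hw (k i), hw₀.comp hk⟩
  simp only [hF, hx.lyapunov_lyapIterate hg]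
  exact EReal.tendsto_coe.2 (hζ.comp hk)

theorem lyapunov_eq_and_hasKLProperty_of_mapClusterPt (hx : IsVMiPiano f g σ α β A L m x)
    (hg : ∀ x, g x ≠ ⊥) (hg_lsc : LowerSemicontinuous g) (hf : ContDiff ℝ 1 f)
    (hK : LipschitzOnWith K (gradient f) (Set.range x)) (hb : Bornology.IsBounded (Set.range x))
    (hKL : ∀ p ∈ LyapRegion N, (limSubdiff (lyapunov f g) p).Nonempty →
      HasKLProperty (lyapunov f g) p)
    (hζ : Tendsto Φ atTop (𝓝 ζ)) (hp : MapClusterPt p atTop ξ) :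
    lyapunov f g p = ζ ∧ HasKLProperty (lyapunov f g) p := by
  obtain ⟨k, hk, hkp⟩ := hp.tendsto_subseq
  have hmap : Tendsto ξ (map k atTop) (𝓝 p) := tendsto_map'_iff.2 hkp
  exact ⟨hx.lyapunov_eq_of_tendsto hg hg_lsc hf hζ hk.tendsto_atTop hmap,
    hKL p (hx.mem_lyapRegion_of_tendsto hmap) ⟨0, hx.zero_mem_limSubdiff_lyapunov_of_tendsto hg
      hg_lsc hf hK hb hζ hk.tendsto_atTop hkp⟩⟩

theorem summable_norm_step (hx : IsVMiPiano f g σ α β A L m x) (hg : ∀ x, g x ≠ ⊥)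
    (hg_lsc : LowerSemicontinuous g) (hf : ContDiff ℝ 1 f)
    (hK : LipschitzOnWith K (gradient f) (Set.range x)) (hb : Bornology.IsBounded (Set.range x))
    (hKL : ∀ p ∈ LyapRegion N, (limSubdiff (lyapunov f g) p).Nonempty →
      HasKLProperty (lyapunov f g) p)
    (hζ : Tendsto Φ atTop (𝓝 ζ)) : Summable fun n => ‖x (n + 1) - x n‖ := by
  obtain ⟨c, hc, hdescent⟩ := hx.exists_lyapValue_descent hg
  obtain ⟨B, hsub⟩ := hx.exists_mem_frechetSubdiff_lyapIterate (hf.differentiable one_ne_zero) hK hb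
  refine summable_of_descent_of_hasKLProperty (B := B) hc (fun n => norm_nonneg _)
    (hx.isBounded_range_lyapIterate hb) (hx.lyapunov_lyapIterate hg) hζ hdescent (fun n => ?_)
    fun p => hx.lyapunov_eq_and_hasKLProperty_of_mapClusterPt hg hg_lsc hf hK hb hKL hζ
  obtain ⟨w, hw, hwn⟩ := hsub (n + 1)
  exact (lazySlope_le (frechetSubdiff_subset_limSubdiff _ _ hw)).trans
    (ENNReal.ofReal_le_ofReal hwn)

theorem lipschitzOnWith_gradient (hx : IsVMiPiano f g σ α β A L m x) {Lf : ℝ} (hLf : 0 ≤ Lf)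
    (hlip : ∀ u ∈ effDom g, ∀ v ∈ effDom g, ‖gradient f u - gradient f v‖ ≤ Lf * ‖u - v‖) :
    LipschitzOnWith ⟨Lf, hLf⟩ (gradient f) (Set.range x) := by
  refine LipschitzOnWith.of_dist_le_mul ?_
  rintro _ ⟨i, rfl⟩ _ ⟨j, rfl⟩
  rw [dist_eq_norm, dist_eq_norm]
  exact hlip _ (hx.mem_effDom i) _ (hx.mem_effDom j)

end IsVMiPiano

end VMiPiano

open VMiPiano in
theorem theorem4p8_general {N : ℕ} {f : Vec N → ℝ} {g : Vec N → EReal} (hf : ContDiff ℝ 1 f)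
    (hg : ∀ x, g x ≠ ⊥) (hg_lsc : LowerSemicontinuous g)
    (hKL : ∀ p ∈ LyapRegion N, (limSubdiff (lyapunov f g) p).Nonempty →
      HasKLProperty (lyapunov f g) p)
    {σ : ℝ} {α β : ℕ → ℝ} {A : ℕ → Matrix (Fin N) (Fin N) ℝ} {L m : ℕ → ℝ} {x : ℕ → Vec N}
    (hx : IsVMiPiano f g σ α β A L m x) {K : NNReal}
    (hK : LipschitzOnWith K (gradient f) (Set.range x)) (hb : Bornology.IsBounded (Set.range x)) :
    Summable (fun k => ‖x (k + 1) - x k‖) ∧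
      ∃ xstar : Vec N, Tendsto x atTop (𝓝 xstar) ∧ IsCriticalPoint (objective f g) xstar ∧
        -gradient f xstar ∈ limSubdiff g xstar := by
  obtain ⟨ζ, hζ⟩ := hx.exists_tendsto_lyapValue hg hg_lsc hf.continuous hb
  have hsum := hx.summable_norm_step hg hg_lsc hf hK hb hKL hζ
  obtain ⟨u, hu⟩ := cauchySeq_tendsto_of_complete
    (cauchySeq_of_summable_dist (f := x) (by simpa only [dist_eq_norm_sub'] using hsum))
  have hcrit := hx.neg_gradient_mem_limSubdiff_of_tendsto hg hg_lsc hf hK hζ hu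
  exact ⟨hsum, u, hu, isCriticalPoint_of_neg_gradient_mem_limSubdiff hf hcrit, hcrit⟩

theorem theorem4p8 (N : ℕ) (hN : 1 ≤ N)
    (f : VMiPiano.Vec N → ℝ) (g : VMiPiano.Vec N → EReal)
    -- `f` is `C¹` with Lipschitz continuous gradient on `dom g`
    (hf : ContDiff ℝ 1 f)
    (Lf : ℝ) (hLf : 0 < Lf)
    (hf_lip : ∀ u ∈ VMiPiano.effDom g, ∀ v ∈ VMiPiano.effDom g,
      ‖gradient f u - gradient f v‖ ≤ Lf * ‖u - v‖)
    -- `g` is proper, lower semicontinuous and prox-bounded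
    (hg_proper : VMiPiano.IsProper g)
    (hg_lsc : LowerSemicontinuous g)
    (hg_prox : VMiPiano.IsProxBounded g)
    -- `h = f + g` is coercive and bounded from below
    (hh_coercive : Tendsto (VMiPiano.objective f g)
      (cocompact (VMiPiano.Vec N)) (𝓝 ⊤))
    (hh_bdd : ∃ c : ℝ, ∀ u, (c : EReal) ≤ VMiPiano.objective f g u)
    -- `F` is a Kurdyka–Łojasiewicz function (on the `(x, y, A, δ)` with `A` positive definite, `δ > 0`)
    (hKL : VMiPiano.IsKLFunctionOn (VMiPiano.lyapunov f g) (VMiPiano.LyapRegion N))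
    -- the data of the algorithm
    (σ : ℝ) (α β : ℕ → ℝ) (A : ℕ → Matrix (Fin N) (Fin N) ℝ) (L m : ℕ → ℝ)
    (x : ℕ → VMiPiano.Vec N)
    (hx : VMiPiano.IsVMiPiano f g σ α β A L m x) :
    Summable (fun k => ‖x (k + 1) - x k‖) ∧
      ∃ xstar : VMiPiano.Vec N, Tendsto x atTop (𝓝 xstar) ∧
        VMiPiano.IsCriticalPoint (VMiPiano.objective f g) xstar ∧
        -gradient f xstar ∈ VMiPiano.limSubdiff g xstar := by
  exact theorem4p8_general hf hg_proper.1 hg_lsc hKL.2 hx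
    (hx.lipschitzOnWith_gradient hLf.le hf_lip)
    (hx.isBounded_range_of_coercive hg_proper.1 hh_coercive)
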